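/- **Setting.** Let $\mathbb{R}_+=[0,\infty)$. A function $\varphi$ is *negative complete Bernstein* ($\varphi\in\mathcal{OM}_-$) if it is holomorphic in $\mathbb{C}\setminus\mathbb{R}_+$, satisfies $\operatorname{Im}w\,\operatorname{Im}\varphi(w)\ge 0$ for all $w\in\mathbb{C}\setminus\mathbb{R}_+$, and the limit $\varphi(-0)=\lim_{x\to 0-}\varphi(x)$ exists and is real; we put $\varphi(0):=\varphi(-0)$. When $\varphi(-0)\le 0$, such a function has an integral representation $$\varphi(z)=c+bz+\int_{(0,\infty)}\frac{z}{t-z}\,d\mu(t),\qquad z\in\mathbb{C}\setminus(0,\infty),$$ with $c\le 0$, $b\ge 0$ and a unique positive measure $\mu$ on $(0,\infty)$ (the representing measure) such that $\int_{(0,\infty)}\frac{d\mu(t)}{1+t}<\infty$. Throughout, $\varphi$ is normalized so that $c=b=0$, that is, $\varphi(-0)=0$ and $\lim_{x\to-\infty}\varphi(x)/x=0$. A closed, densely defined operator $A$ on a complex Banach space $X$ is *nonpositive* if $(0,\infty)$ is contained in its resolvent set and $$M_A:=\sup_{t>0}\|tR(t,A)\|<\infty,\qquad R(t,A)=(tI-A)^{-1}.$$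 For such $A$ and for $\varphi$ as above with representing measure $\mu$, $\varphi(A)$ denotes the closure of the operator $$x\mapsto\int_{(0,\infty)}AR(t,A)x\,d\mu(t),\qquad x\in D(A).$$ A difference $S-T$ of operators has the domain $D(S)\cap D(T)$; it is bounded if $\|(S-T)x\|\le C\|x\|$ on this domain for some constant $C$, and $\|S-T\|$ is the least such $C\ge 0$. **Proposition 3.1.** Let $\varphi\in\mathcal{OM}_-$ with $c=b=0$, and let $A,B$ be nonpositive operators on a complex Banach space $X$ such that $D(A)\subseteq D(B)$ and $A-B$ is bounded. Then $\varphi(A)-\varphi(B)$ is bounded, and $$\|\varphi(A)-\varphi(B)\|\le-(M_A+M_B+M_AM_B)\,\varphi(-\|A-B\|).$$ -/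

import Mathlib

open Set Filter Topology MeasureTheory

namespace HirschCalculus

section Functions

/-- The cut plane `ℂ \ ℝ₊`, where `ℝ₊ = [0, ∞)`. -/
def cutPlane : Set ℂ := {w | ¬ (0 ≤ w.re ∧ w.im = 0)}

/-- Negative complete Bernstein functions: `φ` is holomorphic in `ℂ \ ℝ₊`, satisfies
`Im w * Im (φ w) ≥ 0` there, and has a real limit `φ(-0)` at zero along the negative half-axis.
A member of the class is extended to the point zero by the usual convention `φ 0 = φ(-0)`; its
values on `(0, ∞)` are irrelevant. -/
structure IsNegCompleteBernstein (φ : ℂ → ℂ) : Prop where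
  holomorphic : DifferentiableOn ℂ φ cutPlane
  im_mul_im_nonneg : ∀ w ∈ cutPlane, 0 ≤ w.im * (φ w).im
  tendsto_zero : Tendsto (fun x : ℝ => φ (x : ℂ)) (𝓝[<] 0) (𝓝 (φ 0))
  real_zero : (φ 0).im = 0

/-- The integral representation
`φ(z) = c + b z + ∫_{(0,∞)} z / (t - z) dμ(t)` for `z ∈ ℂ \ (0, ∞)`, where `c ≤ 0`, `b ≥ 0` and
`μ` is a positive measure on `(0, ∞)` (a Borel measure on the line that does not charge
`(-∞, 0]`) such that `∫_{(0,∞)} dμ(t) / (1 + t) < ∞`. -/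
structure IsRepresentation (φ : ℂ → ℂ) (c b : ℝ) (μ : Measure ℝ) : Prop where
  c_nonpos : c ≤ 0
  b_nonneg : 0 ≤ b
  null_Iic : μ (Iic 0) = 0
  integrable : IntegrableOn (fun t : ℝ => (1 + t)⁻¹) (Ioi 0) μ
  eq_integral : ∀ z : ℂ, ¬ (0 < z.re ∧ z.im = 0) →
    φ z = c + b * z + ∫ t in Ioi (0 : ℝ), z / ((t : ℂ) - z) ∂μ

open scoped Classical in
/-- The representing measure of a negative complete Bernstein function. -/
noncomputable def representingMeasure (φ : ℂ → ℂ) : Measure ℝ :=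
  if h : ∃ (μ : Measure ℝ) (c b : ℝ), IsRepresentation φ c b μ then h.choose else 0

end Functions

section Operators

variable {X : Type*} [NormedAddCommGroup X] [NormedSpace ℂ X]

/-- `R` is a bounded everywhere defined two-sided inverse of `z I - A`. -/
def IsResolventAt (A : X →ₗ.[ℂ] X) (z : ℂ) (R : X →L[ℂ] X) : Prop :=
  (∀ y : X, ∃ h : R y ∈ A.domain, z • R y - A ⟨R y, h⟩ = y) ∧
    ∀ x : A.domain, R (z • (x : X) - A x) = x

/-- The resolvent set `ρ(A)`. -/
def resolventSet (A : X →ₗ.[ℂ] X) : Set ℂ := {z | ∃ R : X →L[ℂ] X, IsResolventAt A z R}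

open scoped Classical in
/-- The resolvent `R(z, A) = (z I - A)⁻¹` for `z ∈ ρ(A)` (and zero for other `z`). -/
noncomputable def resolvent (A : X →ₗ.[ℂ] X) (z : ℂ) : X →L[ℂ] X :=
  if h : ∃ R : X →L[ℂ] X, IsResolventAt A z R then h.choose else 0

theorem isResolventAt_resolvent {A : X →ₗ.[ℂ] X} {z : ℂ} (h : z ∈ resolventSet A) :
    IsResolventAt A z (resolvent A z) := by
  have h' : ∃ R : X →L[ℂ] X, IsResolventAt A z R := h
  rw [resolvent, dif_pos h']
  exact h'.choose_spec

theorem resolvent_mem_domain (A : X →ₗ.[ℂ] X) (z : ℂ) (x : X) :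
    resolvent A z x ∈ A.domain := by
  by_cases h : z ∈ resolventSet A
  · exact ((isResolventAt_resolvent h).1 x).1
  · have h' : ¬ ∃ R : X →L[ℂ] X, IsResolventAt A z R := h
    rw [resolvent, dif_neg h']
    exact A.domain.zero_mem

/-- The everywhere defined operator `A R(z, A)`. -/
noncomputable def mulResolvent (A : X →ₗ.[ℂ] X) (z : ℂ) : X →ₗ[ℂ] X :=
  A.toFun ∘ₗ (resolvent A z : X →ₗ[ℂ] X).codRestrict A.domain (resolvent_mem_domain A z)

/-- The constant `M_A = sup_{t > 0} ‖t R(t, A)‖`. -/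
noncomputable def boundConst (A : X →ₗ.[ℂ] X) : ℝ :=
  ⨆ t : Ioi (0 : ℝ), ‖((t : ℝ) : ℂ) • resolvent A ((t : ℝ) : ℂ)‖

/-- Nonpositive operators: closed, densely defined, with `(0, ∞) ⊆ ρ(A)` and
`M_A = sup_{t > 0} ‖t R(t, A)‖ < ∞`. -/
structure IsNonpositive (A : X →ₗ.[ℂ] X) : Prop where
  closed : A.IsClosed
  dense : Dense (A.domain : Set X)
  mem_resolventSet : ∀ t : ℝ, 0 < t → (t : ℂ) ∈ resolventSet A
  bddAbove : BddAbove (range fun t : Ioi (0 : ℝ) =>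
    ‖((t : ℝ) : ℂ) • resolvent A ((t : ℝ) : ℂ)‖)

/-- The operator `x ↦ ∫_{(0,∞)} A R(t, A) x dμ(t)`, defined for those `x ∈ D(A)` for which the
Bochner integral exists. If `A` is nonpositive and `∫_{(0,∞)} dμ(t) / (1 + t) < ∞` these are all
`x ∈ D(A)`, see `integralOperator_domain`. -/
noncomputable def integralOperator (μ : Measure ℝ) (A : X →ₗ.[ℂ] X) : X →ₗ.[ℂ] X where
  domain :=
    { carrier := {x | x ∈ A.domain ∧
        IntegrableOn (fun t : ℝ => mulResolvent A (t : ℂ) x) (Ioi 0) μ}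
      add_mem' := fun {x y} hx hy => ⟨A.domain.add_mem hx.1 hy.1, by
        simp only [map_add]
        exact hx.2.add hy.2⟩
      zero_mem' := ⟨A.domain.zero_mem, by simp⟩
      smul_mem' := fun k x hx => ⟨A.domain.smul_mem k hx.1, by
        simp only [map_smul]
        exact hx.2.smul k⟩ }
  toFun :=
    { toFun := fun x => ∫ t in Ioi (0 : ℝ), mulResolvent A (t : ℂ) (x : X) ∂μ
      map_add' := fun x y => by
        simp only [Submodule.coe_add, map_add]
        exact integral_add x.2.2 y.2.2
      map_smul' := fun k x => by
        simp only [Submodule.coe_smul, map_smul, RingHom.id_apply]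
        exact integral_smul k _ }

/-- The operator `φ(A)`: the closure of `x ↦ ∫_{(0,∞)} A R(t, A) x dμ(t)`, `x ∈ D(A)`, where `μ`
is the representing measure of `φ`. This is the functional calculus for those `φ` whose integral
representation has `c = b = 0`. -/
noncomputable def operatorFunction (φ : ℂ → ℂ) (A : X →ₗ.[ℂ] X) : X →ₗ.[ℂ] X :=
  (integralOperator (representingMeasure φ) A).closure

/-- A partially defined operator is bounded on its domain. -/
def IsBoundedOp (T : X →ₗ.[ℂ] X) : Prop :=
  ∃ C : ℝ, ∀ x : T.domain, ‖T x‖ ≤ C * ‖(x : X)‖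

/-- The norm of a bounded partially defined operator: the least `C ≥ 0` such that
`‖T x‖ ≤ C ‖x‖` on the domain. If the domain is dense this is the norm of the bounded extension
to the whole space. -/
noncomputable def opNorm (T : X →ₗ.[ℂ] X) : ℝ :=
  sInf {C : ℝ | 0 ≤ C ∧ ∀ x : T.domain, ‖T x‖ ≤ C * ‖(x : X)‖}

theorem mulResolvent_eq_smul_sub {A : X →ₗ.[ℂ] X} {z : ℂ} (h : z ∈ resolventSet A) (x : X) :
    mulResolvent A z x = z • resolvent A z x - x := by
  obtain ⟨h1, h2⟩ := (isResolventAt_resolvent h).1 x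
  have h3 : mulResolvent A z x = A ⟨resolvent A z x, h1⟩ := rfl
  rw [h3, eq_sub_iff_add_eq, ← eq_sub_iff_add_eq']
  exact h2.symm

theorem mulResolvent_eq_resolvent {A : X →ₗ.[ℂ] X} {z : ℂ} (h : z ∈ resolventSet A)
    (x : A.domain) : mulResolvent A z (x : X) = resolvent A z (A x) := by
  have h1 := (isResolventAt_resolvent h).2 x
  rw [map_sub, map_smul] at h1
  rw [mulResolvent_eq_smul_sub h]
  nth_rewrite 2 [← h1]
  abel

theorem resolvent_sub {A : X →ₗ.[ℂ] X} {z w : ℂ} (hz : z ∈ resolventSet A)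
    (hw : w ∈ resolventSet A) (x : X) :
    resolvent A z x - resolvent A w x = (w - z) • resolvent A z (resolvent A w x) := by
  have h1 := (isResolventAt_resolvent hz).2 ⟨_, resolvent_mem_domain A w x⟩
  obtain ⟨h, h2⟩ := (isResolventAt_resolvent hw).1 x
  have h3 : A ⟨resolvent A w x, h⟩ = w • resolvent A w x - x := by
    nth_rewrite 3 [← h2]
    abel
  rw [h3] at h1
  simp only [map_sub, map_smul] at h1
  rw [sub_smul, ← sub_eq_zero, ← sub_eq_zero.2 h1]
  abel

theorem IsNonpositive.norm_resolvent_le {A : X →ₗ.[ℂ] X} (hA : IsNonpositive A) {t : ℝ}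
    (ht : 0 < t) : t * ‖resolvent A (t : ℂ)‖ ≤ boundConst A := by
  have h := le_ciSup hA.bddAbove (⟨t, ht⟩ : Ioi (0 : ℝ))
  rw [boundConst]
  refine le_trans (le_of_eq ?_) h
  simp [norm_smul, abs_of_pos ht]

theorem IsNonpositive.continuousOn_resolvent {A : X →ₗ.[ℂ] X} (hA : IsNonpositive A) (x : X) :
    ContinuousOn (fun t : ℝ => resolvent A (t : ℂ) x) (Ioi 0) := by
  intro s hs
  have hs0 : (0 : ℝ) < s := hs
  refine ContinuousAt.continuousWithinAt ?_
  rw [ContinuousAt, tendsto_iff_norm_sub_tendsto_zero]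
  have hb : Tendsto (fun t : ℝ => |s - t| * (boundConst A / t) * ‖resolvent A (s : ℂ) x‖)
      (𝓝 s) (𝓝 (|s - s| * (boundConst A / s) * ‖resolvent A (s : ℂ) x‖)) := by
    have : ContinuousAt (fun t : ℝ => |s - t| * (boundConst A / t) * ‖resolvent A (s : ℂ) x‖) s := by
      have := hs0.ne'
      fun_prop (disch := assumption)
    exact this
  simp only [sub_self, abs_zero, zero_mul] at hb
  refine squeeze_zero' (Eventually.of_forall fun t => norm_nonneg _) ?_ hb
  filter_upwards [Ioi_mem_nhds hs0] with t ht
  have ht0 : (0 : ℝ) < t := ht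
  rw [resolvent_sub (hA.mem_resolventSet t ht0) (hA.mem_resolventSet s hs0), norm_smul, mul_assoc]
  have h1 : ‖((s : ℂ) - (t : ℂ))‖ = |s - t| := by
    rw [← Complex.ofReal_sub, Complex.norm_real, Real.norm_eq_abs]
  rw [h1]
  have h2 : ‖resolvent A (t : ℂ)‖ ≤ boundConst A / t := by
    rw [le_div_iff₀ ht0, mul_comm]
    exact hA.norm_resolvent_le ht0
  have h3 := (resolvent A (t : ℂ)).le_of_opNorm_le h2 (resolvent A (s : ℂ) x)
  gcongr

/-- For nonpositive `A` and `∫_{(0,∞)} dμ(t) / (1 + t) < ∞` the integral operator is defined on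
the whole of `D(A)`. -/
theorem integralOperator_domain {A : X →ₗ.[ℂ] X} (hA : IsNonpositive A) {μ : Measure ℝ}
    (hμ : IntegrableOn (fun t : ℝ => (1 + t)⁻¹) (Ioi 0) μ) :
    (integralOperator μ A).domain = A.domain := by
  ext x
  refine ⟨fun h => h.1, fun hx => ⟨hx, ?_⟩⟩
  set K : ℝ := boundConst A * ‖x‖ + ‖x‖ + boundConst A * ‖A ⟨x, hx⟩‖ with hK
  refine Integrable.mono' (hμ.const_mul K) ?_ ?_
  · refine ContinuousOn.aestronglyMeasurable ?_ measurableSet_Ioi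
    have h1 : ContinuousOn (fun t : ℝ => (t : ℂ) • resolvent A (t : ℂ) x - x) (Ioi 0) :=
      (Complex.continuous_ofReal.continuousOn.smul (hA.continuousOn_resolvent x)).sub
        continuousOn_const
    exact h1.congr fun t ht => mulResolvent_eq_smul_sub (hA.mem_resolventSet t ht) x
  · refine (ae_restrict_iff' measurableSet_Ioi).2 (Eventually.of_forall fun t ht => ?_)
    have ht0 : (0 : ℝ) < t := ht
    have hr := hA.norm_resolvent_le ht0
    have hρ := hA.mem_resolventSet t ht0
    have h1 : ‖mulResolvent A (t : ℂ) x‖ ≤ boundConst A * ‖x‖ + ‖x‖ := by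
      rw [mulResolvent_eq_smul_sub hρ]
      refine (norm_sub_le _ _).trans ?_
      have h2 := (resolvent A (t : ℂ)).le_opNorm x
      have h3 : ‖(t : ℂ) • resolvent A (t : ℂ) x‖ = t * ‖resolvent A (t : ℂ) x‖ := by
        simp [norm_smul, abs_of_pos ht0]
      rw [h3]
      have h4 : t * ‖resolvent A (t : ℂ) x‖ ≤ boundConst A * ‖x‖ :=
        calc t * ‖resolvent A (t : ℂ) x‖ ≤ t * (‖resolvent A (t : ℂ)‖ * ‖x‖) := by gcongr
          _ = t * ‖resolvent A (t : ℂ)‖ * ‖x‖ := by ring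
          _ ≤ boundConst A * ‖x‖ := by gcongr
      linarith
    have h5 : t * ‖mulResolvent A (t : ℂ) x‖ ≤ boundConst A * ‖A ⟨x, hx⟩‖ := by
      rw [mulResolvent_eq_resolvent hρ ⟨x, hx⟩]
      have h2 := (resolvent A (t : ℂ)).le_opNorm (A ⟨x, hx⟩)
      calc _ ≤ t * (‖resolvent A (t : ℂ)‖ * ‖A ⟨x, hx⟩‖) := by gcongr
        _ = t * ‖resolvent A (t : ℂ)‖ * ‖A ⟨x, hx⟩‖ := by ring
        _ ≤ _ := by gcongr
    rw [← div_eq_mul_inv, le_div_iff₀ (by linarith)]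
    linarith

end Operators

end HirschCalculus

/-! ### Resolvent estimates, closability, and passage to closures. -/

namespace HirschCalculus

variable {X : Type*} [NormedAddCommGroup X] [NormedSpace ℂ X]

/-! Put `d = ‖A - B‖`. For `t > 0` the integrands differ by `t (R(t, A) - R(t, B)) x`. The resolvent
bounds alone give norm at most `(M_A + M_B) ‖x‖`; the second resolvent identity gives at most `M_A
M_B (d / t) ‖x‖`. Adding `d` times the first to `t` times the second produces the kernel `d / (t +
d)` (`norm_mulResolvent_sub_le`), and its `μ`-integral is exactly `-φ(-d)` when `c = b = 0`.

Two things remain. The estimate must survive taking closures: the integral operators are closable,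
because composing them with `R(1, A)` makes them bounded, and a bounded difference passes to the
closures (`norm_closure_sub_closure_le`).

Moreover the representing measure must exist, since `representingMeasure` is a choice with default
`0`. The substitution `z = -((1 - ζ) / (1 + ζ))²` maps the disk onto the cut plane and turns `φ`
into a typically real function. Robertson's formula represents it by a finite measure in `θ`,
obtained from the Schwarz formula on smaller circles and weak compactness. Pushing forward by `t =
(1 - cos θ) / (1 + cos θ)` gives `μ`: the mass at `t = ∞` becomes `b`, and the finite limit `φ(-0)`
excludes mass at `t = 0` and gives the integrability of `1 / (1 + t)`. -/

theorem boundConst_nonneg (A : X →ₗ.[ℂ] X) : 0 ≤ boundConst A :=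
  Real.iSup_nonneg fun _ => norm_nonneg _

theorem opNorm_nonneg (T : X →ₗ.[ℂ] X) : 0 ≤ opNorm T :=
  Real.sInf_nonneg fun _ h => h.1

theorem opNorm_le {T : X →ₗ.[ℂ] X} {C : ℝ} (hC : 0 ≤ C)
    (h : ∀ x : T.domain, ‖T x‖ ≤ C * ‖(x : X)‖) : opNorm T ≤ C :=
  csInf_le ⟨0, fun _ h => h.1⟩ ⟨hC, h⟩

theorem IsBoundedOp.norm_apply_le {T : X →ₗ.[ℂ] X} (hT : IsBoundedOp T) (x : T.domain) :
    ‖T x‖ ≤ opNorm T * ‖(x : X)‖ := by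
  obtain ⟨C, hC⟩ := hT
  have hne : {C : ℝ | 0 ≤ C ∧ ∀ x : T.domain, ‖T x‖ ≤ C * ‖(x : X)‖}.Nonempty :=
    ⟨max C 0, le_max_right _ _, fun y => (hC y).trans (by gcongr; exact le_max_left _ _)⟩
  -- The infimum is compared with the quotient `‖T x‖ / ‖x‖`, so `x = 0` is treated apart.
  rcases (norm_nonneg (x : X)).eq_or_lt with h0 | h0
  · have := hC x
    rw [← h0] at this ⊢
    simpa using this
  · rw [← div_le_iff₀ h0]
    refine le_csInf hne fun D hD => ?_
    rw [div_le_iff₀ h0]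
    exact hD.2 x

theorem IsNonpositive.norm_smul_resolvent_apply_le {A : X →ₗ.[ℂ] X} (hA : IsNonpositive A)
    {t : ℝ} (ht : 0 < t) (x : X) : t * ‖resolvent A (t : ℂ) x‖ ≤ boundConst A * ‖x‖ :=
  calc t * ‖resolvent A (t : ℂ) x‖ ≤ t * (‖resolvent A (t : ℂ)‖ * ‖x‖) := by
        gcongr
        exact (resolvent A (t : ℂ)).le_opNorm x
    _ = t * ‖resolvent A (t : ℂ)‖ * ‖x‖ := by ring
    _ ≤ boundConst A * ‖x‖ := by
        gcongr
        exact hA.norm_resolvent_le ht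

theorem apply_resolvent {A : X →ₗ.[ℂ] X} {z : ℂ} (hz : z ∈ resolventSet A) (x : X) :
    A ⟨resolvent A z x, resolvent_mem_domain A z x⟩ = z • resolvent A z x - x :=
  mulResolvent_eq_smul_sub hz x

theorem resolvent_injective {A : X →ₗ.[ℂ] X} {z : ℂ} (hz : z ∈ resolventSet A) {x : X}
    (hx : resolvent A z x = 0) : x = 0 := by
  obtain ⟨h, h1⟩ := (isResolventAt_resolvent hz).1 x
  have h2 : (⟨resolvent A z x, h⟩ : A.domain) = 0 := Subtype.ext hx
  rw [h2, hx] at h1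
  simpa using h1.symm

theorem resolvent_comm {A : X →ₗ.[ℂ] X} {z w : ℂ} (hz : z ∈ resolventSet A)
    (hw : w ∈ resolventSet A) (x : X) :
    resolvent A z (resolvent A w x) = resolvent A w (resolvent A z x) := by
  rcases eq_or_ne z w with rfl | hne
  · rfl
  have h1 := resolvent_sub hz hw x
  have h2 := resolvent_sub hw hz x
  rw [← neg_sub, h1, ← neg_smul, neg_sub] at h2
  exact smul_right_injective X (sub_ne_zero.2 hne) h2

theorem mulResolvent_comm {A : X →ₗ.[ℂ] X} {z w : ℂ} (hz : z ∈ resolventSet A)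
    (hw : w ∈ resolventSet A) (x : X) :
    mulResolvent A z (resolvent A w x) = resolvent A w (mulResolvent A z x) := by
  rw [mulResolvent_eq_smul_sub hz, mulResolvent_eq_smul_sub hz, map_sub, map_smul,
    resolvent_comm hz hw]

/-- The second resolvent identity for `D(A) ⊆ D(B)`. -/
theorem resolvent_sub_resolvent {A B : X →ₗ.[ℂ] X} (hAB : A.domain ≤ B.domain) {z : ℂ}
    (hA : z ∈ resolventSet A) (hB : z ∈ resolventSet B) (x : X) :
    resolvent A z x - resolvent B z x =
      resolvent B z ((A - B) ⟨resolvent A z x, resolvent_mem_domain A z x,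
        hAB (resolvent_mem_domain A z x)⟩) := by
  have h1 := (isResolventAt_resolvent hB).2 ⟨_, hAB (resolvent_mem_domain A z x)⟩
  have h2 := apply_resolvent hA x
  rw [LinearPMap.sub_apply, h2, map_sub, map_sub]
  rw [map_sub] at h1
  simp only at h1
  nth_rewrite 1 [← h1]
  abel

theorem norm_mulResolvent_sub_le {A B : X →ₗ.[ℂ] X} (hA : IsNonpositive A)
    (hB : IsNonpositive B) (hAB : A.domain ≤ B.domain) (hbdd : IsBoundedOp (A - B))
    {t : ℝ} (ht : 0 < t) (x : X) :
    ‖mulResolvent A (t : ℂ) x - mulResolvent B (t : ℂ) x‖ ≤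
      (boundConst A + boundConst B + boundConst A * boundConst B) * ‖x‖ *
        (opNorm (A - B) / (t + opNorm (A - B))) := by
  have hρA := hA.mem_resolventSet t ht
  have hρB := hB.mem_resolventSet t ht
  have hd := opNorm_nonneg (A - B)
  set d := opNorm (A - B) with hd'
  have hMA := boundConst_nonneg A
  have hMB := boundConst_nonneg B
  have hx := norm_nonneg x
  have e : mulResolvent A (t : ℂ) x - mulResolvent B (t : ℂ) x =
      (t : ℂ) • (resolvent A (t : ℂ) x - resolvent B (t : ℂ) x) := by
    rw [mulResolvent_eq_smul_sub hρA, mulResolvent_eq_smul_sub hρB, smul_sub]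
    abel
  have en : ‖mulResolvent A (t : ℂ) x - mulResolvent B (t : ℂ) x‖ =
      t * ‖resolvent A (t : ℂ) x - resolvent B (t : ℂ) x‖ := by
    rw [e, norm_smul, Complex.norm_real, Real.norm_of_nonneg ht.le]
  have hrA := hA.norm_smul_resolvent_apply_le ht x
  have hrB := hB.norm_smul_resolvent_apply_le ht x
  have h1 : t * ‖resolvent A (t : ℂ) x - resolvent B (t : ℂ) x‖ ≤
      (boundConst A + boundConst B) * ‖x‖ :=
    calc _ ≤ t * (‖resolvent A (t : ℂ) x‖ + ‖resolvent B (t : ℂ) x‖) := by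
          gcongr
          exact norm_sub_le _ _
      _ ≤ _ := by linarith
  have h2 : t * (t * ‖resolvent A (t : ℂ) x - resolvent B (t : ℂ) x‖) ≤
      boundConst A * boundConst B * d * ‖x‖ := by
    rw [resolvent_sub_resolvent hAB hρA hρB]
    calc _ ≤ t * (boundConst B * (d * ‖resolvent A (t : ℂ) x‖)) := by
          refine mul_le_mul_of_nonneg_left ((hB.norm_smul_resolvent_apply_le ht _).trans ?_) ht.le
          exact mul_le_mul_of_nonneg_left (hbdd.norm_apply_le _) hMB
      _ = boundConst B * d * (t * ‖resolvent A (t : ℂ) x‖) := by ring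
      _ ≤ boundConst B * d * (boundConst A * ‖x‖) := by gcongr
      _ = _ := by ring
  rw [en, ← mul_div_assoc, le_div_iff₀ (by linarith)]
  -- `h2` plus `d` times `h1`; the surplus `M_A M_B d` and `(M_A + M_B) d` terms add up to the
  -- constant.
  nlinarith [mul_le_mul_of_nonneg_right h1 hd]

theorem integralOperator_apply (μ : Measure ℝ) (A : X →ₗ.[ℂ] X)
    (x : (integralOperator μ A).domain) :
    integralOperator μ A x = ∫ t in Ioi (0 : ℝ), mulResolvent A (t : ℂ) (x : X) ∂μ := rfl

theorem integrableOn_div_add {μ : Measure ℝ}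
    (hμ : IntegrableOn (fun t : ℝ => (1 + t)⁻¹) (Ioi 0) μ) {d : ℝ} (hd : 0 ≤ d) :
    IntegrableOn (fun t : ℝ => d / (t + d)) (Ioi 0) μ := by
  refine Integrable.mono' (hμ.const_mul (max d 1)) ?_ ?_
  · exact (by fun_prop : Measurable fun t : ℝ => d / (t + d)).aestronglyMeasurable
  · refine (ae_restrict_iff' measurableSet_Ioi).2 (Eventually.of_forall fun t ht => ?_)
    have ht0 : (0 : ℝ) < t := ht
    rw [Real.norm_of_nonneg (by positivity), ← div_eq_mul_inv,
      div_le_div_iff₀ (by positivity) (by positivity)]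
    rcases le_total d 1 with h | h
    · rw [max_eq_right h]
      nlinarith
    · rw [max_eq_left h]
      nlinarith

theorem norm_integralOperator_sub_le [CompleteSpace X] {A B : X →ₗ.[ℂ] X} (hA : IsNonpositive A)
    (hB : IsNonpositive B) (hAB : A.domain ≤ B.domain) (hbdd : IsBoundedOp (A - B))
    {μ : Measure ℝ} (hμ : IntegrableOn (fun t : ℝ => (1 + t)⁻¹) (Ioi 0) μ)
    (x : (integralOperator μ A).domain) (y : (integralOperator μ B).domain)
    (hxy : (x : X) = y) :
    ‖integralOperator μ A x - integralOperator μ B y‖ ≤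
      (boundConst A + boundConst B + boundConst A * boundConst B) *
        (∫ t in Ioi (0 : ℝ), opNorm (A - B) / (t + opNorm (A - B)) ∂μ) * ‖(x : X)‖ := by
  rw [integralOperator_apply, integralOperator_apply, ← hxy,
    ← integral_sub x.2.2 (hxy ▸ y.2.2)]
  refine (norm_integral_le_of_norm_le (((integrableOn_div_add hμ (opNorm_nonneg (A - B)))).const_mul
    ((boundConst A + boundConst B + boundConst A * boundConst B) * ‖(x : X)‖)) ?_).trans ?_
  · exact (ae_restrict_iff' measurableSet_Ioi).2 (Eventually.of_forall fun t ht =>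
      norm_mulResolvent_sub_le hA hB hAB hbdd ht _)
  · rw [integral_const_mul]
    exact le_of_eq (by ring)

/-- The integral operator composed with a resolvent is bounded on `D(A)`, and the two commute. -/
theorem exists_resolvent_integralOperator_le [CompleteSpace X] {A : X →ₗ.[ℂ] X}
    (hA : IsNonpositive A) {μ : Measure ℝ}
    (hμ : IntegrableOn (fun t : ℝ => (1 + t)⁻¹) (Ioi 0) μ) :
    ∃ C : ℝ, ∀ x : (integralOperator μ A).domain,
      ‖resolvent A ((1 : ℝ) : ℂ) (integralOperator μ A x)‖ ≤ C * ‖(x : X)‖ := by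
  have hρ1 := hA.mem_resolventSet 1 one_pos
  have hM := boundConst_nonneg A
  -- The two summands bound `‖v‖` and `t ‖v‖` for `v = R(1, A) A R(t, A) x`, so that `(1 + t) ‖v‖ ≤
  -- K ‖x‖`.
  set K : ℝ := (1 + boundConst A) * boundConst A + boundConst A * (boundConst A + 1) with hK
  refine ⟨K * ∫ t in Ioi (0 : ℝ), (1 + t)⁻¹ ∂μ, fun x => ?_⟩
  rw [integralOperator_apply, ← ContinuousLinearMap.integral_comp_comm _ x.2.2]
  refine (norm_integral_le_of_norm_le (hμ.const_mul (K * ‖(x : X)‖)) ?_).trans ?_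
  · refine (ae_restrict_iff' measurableSet_Ioi).2 (Eventually.of_forall fun t ht => ?_)
    have ht0 : (0 : ℝ) < t := ht
    have hρ := hA.mem_resolventSet t ht0
    have hx := norm_nonneg (x : X)
    have hM1 : ∀ (s : ℝ), 0 < s → ∀ u : X, ‖mulResolvent A (s : ℂ) u‖ ≤ (boundConst A + 1) * ‖u‖ := by
      intro s hs u
      rw [mulResolvent_eq_smul_sub (hA.mem_resolventSet s hs)]
      refine (norm_sub_le _ _).trans ?_
      rw [norm_smul, Complex.norm_real, Real.norm_of_nonneg hs.le]
      linarith [hA.norm_smul_resolvent_apply_le hs u]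
    have hR1 : ∀ u : X, ‖resolvent A ((1 : ℝ) : ℂ) u‖ ≤ boundConst A * ‖u‖ := fun u => by
      simpa using hA.norm_smul_resolvent_apply_le one_pos u
    have h1 : ‖resolvent A ((1 : ℝ) : ℂ) (mulResolvent A (t : ℂ) (x : X))‖ ≤
        boundConst A * ((boundConst A + 1) * ‖(x : X)‖) :=
      (hR1 _).trans (by gcongr; exact hM1 t ht0 _)
    have h2 : t * ‖resolvent A ((1 : ℝ) : ℂ) (mulResolvent A (t : ℂ) (x : X))‖ ≤
        boundConst A * ((boundConst A + 1) * ‖(x : X)‖) := by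
      -- `R(1, A) A R(t, A) x = R(t, A) A R(1, A) x`: the factor `A` moves onto `R(1, A)`, which
      -- frees `R(t, A)` to supply the decay `1 / t`.
      rw [← mulResolvent_comm hρ hρ1, mulResolvent_eq_resolvent hρ
        ⟨_, resolvent_mem_domain A ((1 : ℝ) : ℂ) (x : X)⟩]
      refine (hA.norm_smul_resolvent_apply_le ht0 _).trans ?_
      gcongr
      exact hM1 1 one_pos _
    rw [← div_eq_mul_inv, le_div_iff₀ (by linarith), hK]
    linarith
  · rw [integral_const_mul]
    exact le_of_eq (by ring)

/-- If `x_n → 0` and the images tend to `y`, boundedness after composition with `R(1, A)` forces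
`R(1, A) y = 0`, and resolvents are injective. -/
theorem isClosable_integralOperator [CompleteSpace X] {A : X →ₗ.[ℂ] X}
    (hA : IsNonpositive A) {μ : Measure ℝ}
    (hμ : IntegrableOn (fun t : ℝ => (1 + t)⁻¹) (Ioi 0) μ) :
    (integralOperator μ A).IsClosable := by
  obtain ⟨C, hC⟩ := exists_resolvent_integralOperator_le hA hμ
  refine ⟨(integralOperator μ A).graph.topologicalClosure.toLinearPMap, ?_⟩
  rw [Submodule.toLinearPMap_graph_eq]
  rintro ⟨x, y⟩ hx (rfl : x = 0)
  have hcl : (0, y) ∈ closure ((integralOperator μ A).graph : Set (X × X)) := hx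
  have hsub : closure ((integralOperator μ A).graph : Set (X × X)) ⊆
      {p : X × X | ‖resolvent A ((1 : ℝ) : ℂ) p.2‖ ≤ C * ‖p.1‖} := by
    refine closure_minimal ?_ (isClosed_le (by fun_prop) (by fun_prop))
    rintro ⟨u, v⟩ huv
    obtain ⟨w, rfl, rfl⟩ := (LinearPMap.mem_graph_iff _).1 huv
    exact hC w
  have h0 : ‖resolvent A ((1 : ℝ) : ℂ) y‖ ≤ C * ‖(0 : X)‖ := hsub hcl
  rw [norm_zero, mul_zero, norm_le_zero_iff] at h0
  exact resolvent_injective (hA.mem_resolventSet 1 one_pos) h0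

/-- Approximate `x` by `u_n` in the graph of `S`. The differences `S u_n - T u_n` are Cauchy by the
bound, so `T u_n` converges too, and closedness identifies its limit as `T.closure x`. Thus one
sequence serves both closures. -/
theorem norm_closure_sub_closure_le [CompleteSpace X] {S T : X →ₗ.[ℂ] X} (hS : S.IsClosable)
    (hT : T.IsClosable) (hST : S.domain ≤ T.domain) {C : ℝ}
    (h : ∀ (x : S.domain) (y : T.domain), (x : X) = y → ‖S x - T y‖ ≤ C * ‖(x : X)‖)
    (x : (S.closure - T.closure).domain) :
    ‖(S.closure - T.closure) x‖ ≤ C * ‖(x : X)‖ := by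
  obtain ⟨x, hxS, hxT⟩ := x
  rw [LinearPMap.sub_apply]
  have hg : (x, S.closure ⟨x, hxS⟩) ∈ closure (S.graph : Set (X × X)) := by
    have := LinearPMap.mem_graph S.closure ⟨x, hxS⟩
    rw [← hS.graph_closure_eq_closure_graph] at this
    exact this
  obtain ⟨p, hp, hlim⟩ := mem_closure_iff_seq_limit.1 hg
  choose u hu1 hu2 using fun n => (LinearPMap.mem_graph_iff _).1 (hp n)
  let w : ℕ → T.domain := fun n => ⟨u n, hST (u n).2⟩
  have hlim1 : Tendsto (fun n => (u n : X)) atTop (𝓝 x) := by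
    simpa only [hu1] using hlim.fst_nhds
  have hlim2 : Tendsto (fun n => S (u n)) atTop (𝓝 (S.closure ⟨x, hxS⟩)) := by
    simpa only [hu2] using hlim.snd_nhds
  have hC : CauchySeq fun n => S (u n) - T (w n) := by
    have hcu := hlim1.cauchySeq
    rw [Metric.cauchySeq_iff'] at hcu ⊢
    intro ε hε
    -- No sign of `C` is assumed; `|C| + 1` is a positive substitute.
    obtain ⟨N, hN⟩ := hcu (ε / (|C| + 1)) (by positivity)
    refine ⟨N, fun n hn => ?_⟩
    have h1 := h (u n - u N) (w n - w N) rfl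
    rw [LinearPMap.map_sub, LinearPMap.map_sub] at h1
    have h2 := hN n hn
    rw [dist_eq_norm] at h2 ⊢
    rw [lt_div_iff₀ (by positivity)] at h2
    have h3 : S (u n) - T (w n) - (S (u N) - T (w N)) =
        S (u n) - S (u N) - (T (w n) - T (w N)) := by abel
    rw [h3]
    refine h1.trans_lt (lt_of_le_of_lt ?_ h2)
    rw [mul_comm]
    refine mul_le_mul_of_nonneg_left ?_ (norm_nonneg _)
    linarith [le_abs_self C]
  obtain ⟨l, hl⟩ := cauchySeq_tendsto_of_complete hC
  have hlimT : Tendsto (fun n => T (w n)) atTop (𝓝 (S.closure ⟨x, hxS⟩ - l)) := by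
    simpa using hlim2.sub hl
  have hgT : (x, S.closure ⟨x, hxS⟩ - l) ∈ T.closure.graph := by
    rw [← hT.graph_closure_eq_closure_graph]
    refine mem_closure_of_tendsto (hlim1.prodMk_nhds hlimT) (Eventually.of_forall fun n => ?_)
    exact LinearPMap.mem_graph T (w n)
  have heq := LinearPMap.mem_graph_snd_inj _ hgT (LinearPMap.mem_graph T.closure ⟨x, hxT⟩) rfl
  have hval : S.closure ⟨x, hxS⟩ - T.closure ⟨x, hxT⟩ = l := by
    rw [← heq]
    abel
  have : ‖l‖ ≤ C * ‖x‖ :=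
    le_of_tendsto_of_tendsto' hl.norm (hlim1.norm.const_mul C) fun n => h _ _ rfl
  rw [← hval] at this
  exact this

end HirschCalculus

/-! ### The Schwarz formula for typically real functions on the disk. -/

namespace HirschCalculus

section Disk

open Complex Metric ComplexConjugate

/-- The kernel `2 ζ / (1 - 2 ζ cos θ + ζ²)` of Robertson's representation of typically real
functions. -/
noncomputable def diskKernel (ζ : ℂ) (θ : ℝ) : ℂ :=
  2 * ζ / (1 - 2 * (Real.cos θ : ℂ) * ζ + ζ ^ 2)

theorem ofReal_cos_eq_circleMap (θ : ℝ) :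
    (Real.cos θ : ℂ) = (circleMap 0 1 θ + (circleMap 0 1 θ)⁻¹) / 2 := by
  simp [circleMap, Complex.cos, ← Complex.exp_neg]

theorem ofReal_sin_eq_circleMap (θ : ℝ) :
    (Real.sin θ : ℂ) = ((circleMap 0 1 θ)⁻¹ - circleMap 0 1 θ) * I / 2 := by
  simp [circleMap, Complex.sin, ← Complex.exp_neg]

theorem one_sub_ne_zero_of_norm_lt {w : ℂ} (hw : ‖w‖ < 1) : 1 - w ≠ 0 := by
  intro h
  rw [← sub_eq_zero.1 h, norm_one] at hw
  exact lt_irrefl _ hw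

theorem diskKernel_denom_eq (ζ : ℂ) (θ : ℝ) :
    1 - 2 * (Real.cos θ : ℂ) * ζ + ζ ^ 2 =
      (1 - circleMap 0 1 θ * ζ) * (1 - (circleMap 0 1 θ)⁻¹ * ζ) := by
  have h0 : circleMap 0 1 θ ≠ 0 := circleMap_ne_center one_ne_zero
  rw [ofReal_cos_eq_circleMap]
  field_simp
  ring

theorem diskKernel_denom_lower_bound {ζ : ℂ} (hζ : ‖ζ‖ < 1) (θ : ℝ) :
    (1 - ‖ζ‖) ^ 2 ≤ ‖1 - 2 * (Real.cos θ : ℂ) * ζ + ζ ^ 2‖ := by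
  rw [diskKernel_denom_eq, norm_mul, sq]
  have h (w : ℂ) (hw : ‖w‖ = 1) : 1 - ‖ζ‖ ≤ ‖1 - w * ζ‖ := by
    have := norm_sub_norm_le (1 : ℂ) (w * ζ)
    rwa [norm_mul, hw, one_mul, norm_one] at this
  have h1 : 0 ≤ 1 - ‖ζ‖ := by linarith
  exact mul_le_mul (h _ (by simp)) (h _ (by simp)) h1 (norm_nonneg _)

theorem diskKernel_denom_ne_zero {ζ : ℂ} (hζ : ‖ζ‖ < 1) (θ : ℝ) :
    1 - 2 * (Real.cos θ : ℂ) * ζ + ζ ^ 2 ≠ 0 :=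
  norm_pos_iff.1 (lt_of_lt_of_le (pow_pos (by linarith) 2) (diskKernel_denom_lower_bound hζ θ))

theorem continuous_diskKernel {ζ : ℂ} (hζ : ‖ζ‖ < 1) : Continuous (diskKernel ζ) := by
  unfold diskKernel
  refine Continuous.div (by fun_prop) (by fun_prop) (diskKernel_denom_ne_zero hζ)

theorem norm_diskKernel_le {ζ : ℂ} (hζ : ‖ζ‖ < 1) (θ : ℝ) :
    ‖diskKernel ζ θ‖ ≤ 2 * ‖ζ‖ / (1 - ‖ζ‖) ^ 2 := by
  have h1 : 0 < 1 - ‖ζ‖ := by linarith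
  rw [diskKernel, norm_div, norm_mul, Complex.norm_ofNat]
  gcongr
  exact diskKernel_denom_lower_bound hζ θ

/-- Partial fractions in `e^{iθ}`: the first term is the Cauchy kernel, while the second is
holomorphic in the boundary variable and contributes only the value at the centre. -/
theorem sin_mul_diskKernel {ζ : ℂ} (hζ : ‖ζ‖ < 1) (θ : ℝ) :
    (Real.sin θ : ℂ) * diskKernel ζ θ =
      I * (circleMap 0 1 θ / (circleMap 0 1 θ - ζ) - (1 - ζ * circleMap 0 1 θ)⁻¹) := by
  have h0 : circleMap 0 1 θ ≠ 0 := circleMap_ne_center one_ne_zero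
  have h1 : 1 - circleMap 0 1 θ * ζ ≠ 0 := one_sub_ne_zero_of_norm_lt (by simpa using hζ)
  have h2 : 1 - (circleMap 0 1 θ)⁻¹ * ζ ≠ 0 := one_sub_ne_zero_of_norm_lt (by simpa using hζ)
  have h3 : circleMap 0 1 θ - ζ ≠ 0 := by
    intro h
    rw [← sub_eq_zero.1 h] at hζ
    simp at hζ
  rw [diskKernel, diskKernel_denom_eq, ofReal_sin_eq_circleMap]
  rw [mul_comm ζ (circleMap 0 1 θ)]
  generalize circleMap 0 1 θ = e at *
  field_simp
  ring

/-- Cauchy's formula integrated against the odd part of the Schwarz kernel. -/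
theorem integral_sin_mul_diskKernel_mul {G : ℂ → ℂ} (hG : DiffContOnCl ℂ G (ball 0 1)) {ζ : ℂ}
    (hζ : ‖ζ‖ < 1) :
    ∫ θ in 0..2 * Real.pi, (Real.sin θ : ℂ) * diskKernel ζ θ * G (circleMap 0 1 θ) =
      (2 * Real.pi : ℝ) • (I * (G ζ - G 0)) := by
  have hG' : DiffContOnCl ℂ G (ball 0 |1|) := by simpa using hG
  have hcl : closure (ball (0 : ℂ) |1|) = closedBall 0 1 := by
    rw [abs_one, closure_ball _ one_ne_zero]
  have hcont : ContinuousOn G (closedBall 0 1) := hcl ▸ hG'.continuousOn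
  have hmem (θ : ℝ) : circleMap 0 1 θ ∈ closedBall (0 : ℂ) 1 := by simp
  have hGc : Continuous fun θ : ℝ => G (circleMap 0 1 θ) :=
    hcont.comp_continuous (continuous_circleMap 0 1) hmem
  have hden (w : ℂ) (hw : w ∈ closedBall (0 : ℂ) 1) : 1 - ζ * w ≠ 0 := by
    refine one_sub_ne_zero_of_norm_lt ?_
    rw [norm_mul]
    rw [mem_closedBall_zero_iff] at hw
    nlinarith [norm_nonneg ζ, norm_nonneg w]
  have h1 := hG'.circleAverage_smul_div (w := ζ) (by simpa using hζ)
  have hK : DiffContOnCl ℂ (fun w => (1 - ζ * w)⁻¹) (ball 0 |1|) := by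
    refine DiffContOnCl.inv (Differentiable.diffContOnCl (by fun_prop)) fun w hw => hden w ?_
    rwa [← hcl]
  have h2 := (hK.smul hG').circleAverage
  have hc1 : Continuous fun θ : ℝ =>
      (circleMap 0 1 θ / (circleMap 0 1 θ - ζ)) * G (circleMap 0 1 θ) := by
    refine Continuous.mul (Continuous.div (continuous_circleMap 0 1)
      ((continuous_circleMap 0 1).sub continuous_const) fun θ h => ?_) hGc
    rw [← sub_eq_zero.1 h] at hζ
    simp at hζ
  have hc2 : Continuous fun θ : ℝ => (1 - ζ * circleMap 0 1 θ)⁻¹ * G (circleMap 0 1 θ) :=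
    Continuous.mul (Continuous.inv₀ (by fun_prop) fun θ => hden _ (hmem θ)) hGc
  rw [Real.circleAverage_def, inv_smul_eq_iff₀ (by positivity)] at h1 h2
  simp only [sub_zero, smul_eq_mul, mul_zero, inv_one, one_mul] at h1 h2
  have h3 : ∀ θ : ℝ, (Real.sin θ : ℂ) * diskKernel ζ θ * G (circleMap 0 1 θ) =
      I * ((circleMap 0 1 θ / (circleMap 0 1 θ - ζ)) * G (circleMap 0 1 θ) -
        (1 - ζ * circleMap 0 1 θ)⁻¹ * G (circleMap 0 1 θ)) := fun θ => by
    rw [sin_mul_diskKernel hζ]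
    ring
  simp only [h3]
  rw [intervalIntegral.integral_const_mul, intervalIntegral.integral_sub
    (hc1.intervalIntegrable _ _) (hc2.intervalIntegrable _ _), h1, h2]
  simp only [real_smul]
  ring

theorem diskKernel_conj (ζ : ℂ) (θ : ℝ) : diskKernel (conj ζ) θ = conj (diskKernel ζ θ) := by
  simp only [diskKernel, map_div₀, map_mul, map_add, map_sub, map_pow, map_one, map_ofNat,
    conj_ofReal]

/-- The Schwarz formula for functions that are real on the real axis. -/
theorem integral_im_mul_sin_mul_diskKernel {G : ℂ → ℂ} (hG : DiffContOnCl ℂ G (ball 0 1))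
    (hconj : ∀ w ∈ ball (0 : ℂ) 1, G (conj w) = conj (G w)) {ζ : ℂ} (hζ : ‖ζ‖ < 1) :
    ∫ θ in 0..2 * Real.pi, (((G (circleMap 0 1 θ)).im * Real.sin θ : ℝ) : ℂ) * diskKernel ζ θ =
      (2 * Real.pi : ℝ) • (G ζ - G 0) := by
  have hcont : ContinuousOn G (closedBall 0 1) := by
    rw [← closure_ball _ one_ne_zero]
    exact hG.continuousOn
  have hGc : Continuous fun θ : ℝ => G (circleMap 0 1 θ) :=
    hcont.comp_continuous (continuous_circleMap 0 1) fun θ => by simp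
  have h1 := integral_sin_mul_diskKernel_mul hG hζ
  -- The formula at `conj ζ`, conjugated, is the formula at `ζ` for `conj G` with `I` replaced by
  -- `-I`. Subtracting the two isolates `Im G`.
  have h2 := congrArg conj (integral_sin_mul_diskKernel_mul hG (ζ := conj ζ) (by simpa using hζ))
  rw [hconj ζ (by simpa using hζ), intervalIntegral.integral_of_le (by positivity),
    ← integral_conj, ← intervalIntegral.integral_of_le (by positivity)] at h2
  have hG0 : conj (G 0) = G 0 := by simpa using (hconj 0 (by simp)).symm
  simp only [map_mul, diskKernel_conj, conj_conj, conj_ofReal, real_smul, map_sub, conj_I, hG0]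
    at h2
  have hs : Continuous fun θ : ℝ => (Real.sin θ : ℂ) * diskKernel ζ θ :=
    Continuous.mul (by fun_prop) (continuous_diskKernel hζ)
  have h3 : ∀ θ : ℝ, (((G (circleMap 0 1 θ)).im * Real.sin θ : ℝ) : ℂ) * diskKernel ζ θ =
      (2 * I)⁻¹ * ((Real.sin θ : ℂ) * diskKernel ζ θ * G (circleMap 0 1 θ) -
        (Real.sin θ : ℂ) * diskKernel ζ θ * conj (G (circleMap 0 1 θ))) := fun θ => by
    rw [ofReal_mul, im_eq_sub_conj]
    ring
  simp only [h3]
  have hi1 : Continuous fun θ : ℝ =>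
      (Real.sin θ : ℂ) * diskKernel ζ θ * G (circleMap 0 1 θ) := hs.mul hGc
  have hi2 : Continuous fun θ : ℝ =>
      (Real.sin θ : ℂ) * diskKernel ζ θ * conj (G (circleMap 0 1 θ)) :=
    hs.mul (continuous_conj.comp hGc)
  rw [intervalIntegral.integral_const_mul, intervalIntegral.integral_sub
    (hi1.intervalIntegrable _ _) (hi2.intervalIntegrable _ _), h1, h2]
  simp only [real_smul]
  field_simp
  ring

/-- A function on the disk that is typically real in the weak sense commutes with conjugation. -/
theorem apply_conj_of_im_mul_im_nonneg {F : ℂ → ℂ} (hF : DifferentiableOn ℂ F (ball 0 1))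
    (him : ∀ w ∈ ball (0 : ℂ) 1, 0 ≤ w.im * (F w).im) {w : ℂ} (hw : w ∈ ball (0 : ℂ) 1) :
    F (conj w) = conj (F w) := by
  -- The sign condition makes `Im F` nonnegative just above the real axis and nonpositive just below
  -- it.
  have hreal : ∀ s : ℝ, (s : ℂ) ∈ ball (0 : ℂ) 1 → (F s).im = 0 := by
    intro s hs
    have hc : ContinuousAt (fun y : ℝ => (F (s + y * I)).im) 0 := by
      have h1 : ContinuousAt F (s + ((0 : ℝ) : ℂ) * I) := by
        simpa using (hF.differentiableAt (isOpen_ball.mem_nhds hs)).continuousAt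
      exact continuous_im.continuousAt.comp (ContinuousAt.comp (f := fun y : ℝ => (s : ℂ) + y * I)
        h1 (by fun_prop))
    have hball : ∀ᶠ y : ℝ in 𝓝 0, (s : ℂ) + y * I ∈ ball (0 : ℂ) 1 := by
      have h2 : ContinuousAt (fun y : ℝ => (s : ℂ) + y * I) 0 := by fun_prop
      exact h2.eventually_mem (isOpen_ball.mem_nhds (by simpa using hs))
    have hlim : Tendsto (fun y : ℝ => (F (s + y * I)).im) (𝓝 0) (𝓝 (F s).im) := by
      simpa [ContinuousAt] using hc
    refine le_antisymm ?_ ?_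
    · refine le_of_tendsto (hlim.mono_left (nhdsWithin_le_nhds (s := Iio 0))) ?_
      filter_upwards [self_mem_nhdsWithin, nhdsWithin_le_nhds hball] with y hy hb
      have := him _ hb
      simp only [add_im, ofReal_im, mul_im, ofReal_re, I_im, mul_one, I_re, mul_zero, add_zero,
        zero_add] at this
      have hy' : y < 0 := hy
      nlinarith
    · refine ge_of_tendsto (hlim.mono_left (nhdsWithin_le_nhds (s := Ioi 0))) ?_
      filter_upwards [self_mem_nhdsWithin, nhdsWithin_le_nhds hball] with y hy hb
      have := him _ hb
      simp only [add_im, ofReal_im, mul_im, ofReal_re, I_im, mul_one, I_re, mul_zero, add_zero,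
        zero_add] at this
      exact nonneg_of_mul_nonneg_right this hy
  have hG : DifferentiableOn ℂ (fun w => conj (F (conj w))) (ball 0 1) := by
    intro u hu
    have hu' : conj u ∈ ball (0 : ℂ) 1 := by simpa using hu
    have h1 := (hF.differentiableAt (isOpen_ball.mem_nhds hu')).conj_conj
    rw [conj_conj] at h1
    exact h1.differentiableWithinAt
  have heq : EqOn F (fun w => conj (F (conj w))) (ball 0 1) := by
    refine AnalyticOnNhd.eqOn_of_preconnected_of_frequently_eq (hF.analyticOnNhd isOpen_ball)
      (hG.analyticOnNhd isOpen_ball) (convex_ball 0 1).isPreconnected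
      (mem_ball_self one_pos) ?_
    have hfr : ∃ᶠ s : ℝ in 𝓝[≠] 0, F (s : ℂ) = conj (F (conj (s : ℂ))) := by
      have h1 : ∀ᶠ s : ℝ in 𝓝[≠] 0, (s : ℂ) ∈ ball (0 : ℂ) 1 := by
        refine nhdsWithin_le_nhds (continuous_ofReal.continuousAt.eventually_mem
          (isOpen_ball.mem_nhds ?_))
        simp
      refine (h1.mono fun s hs => ?_).frequently
      rw [conj_ofReal, eq_comm, conj_eq_iff_im]
      exact hreal s hs
    have ht : Tendsto (fun s : ℝ => (s : ℂ)) (𝓝[≠] 0) (𝓝[≠] 0) := by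
      refine tendsto_nhdsWithin_iff.2 ⟨?_, ?_⟩
      · exact (continuous_ofReal.tendsto' 0 0 ofReal_zero).mono_left nhdsWithin_le_nhds
      · filter_upwards [self_mem_nhdsWithin] with s hs
        simpa using hs
    exact ht.frequently hfr
  have := heq (show conj w ∈ ball (0 : ℂ) 1 by simpa using hw)
  simpa using this

end Disk

end HirschCalculus

/-! ### Robertson's representation by a finite measure. -/

namespace HirschCalculus

section Robertson

open Complex Metric ComplexConjugate

theorem integrable_diskKernel (ν : Measure ℝ) [IsFiniteMeasure ν] {ζ : ℂ} (hζ : ‖ζ‖ < 1) :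
    Integrable (diskKernel ζ) ν :=
  Integrable.of_bound (continuous_diskKernel hζ).aestronglyMeasurable _
    (Eventually.of_forall (norm_diskKernel_le hζ))

/-- At `ζ = 1/2` the kernel is `1 / (5/4 - cos θ) ≥ 4/9`. This gives the uniform mass bound needed
for weak compactness. -/
theorem mass_le_norm_integral_diskKernel (ν : FiniteMeasure ℝ) :
    (ν.mass : ℝ) ≤ 9 / 4 * ‖∫ θ, diskKernel (1 / 2) θ ∂(ν : Measure ℝ)‖ := by
  have hhalf : ‖(1 / 2 : ℂ)‖ < 1 := by norm_num
  have hre : ∀ θ : ℝ, 4 / 9 ≤ (diskKernel (1 / 2) θ).re := by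
    intro θ
    have h1 : diskKernel (1 / 2) θ = ((1 / (5 / 4 - Real.cos θ) : ℝ) : ℂ) := by
      rw [diskKernel]
      push_cast
      congr 1 <;> ring
    rw [h1, ofReal_re, div_le_div_iff₀ (by norm_num) (by linarith [Real.cos_le_one θ])]
    linarith [Real.neg_one_le_cos θ]
  have hint := integrable_diskKernel (ν : Measure ℝ) hhalf
  have h2 : ∫ _θ : ℝ, (4 / 9 : ℝ) ∂(ν : Measure ℝ) ≤
      ∫ θ, (diskKernel (1 / 2) θ).re ∂(ν : Measure ℝ) :=
    integral_mono (integrable_const _) hint.re hre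
  have h3 : ∫ θ, (diskKernel (1 / 2) θ).re ∂(ν : Measure ℝ) =
      (∫ θ, diskKernel (1 / 2) θ ∂(ν : Measure ℝ)).re := integral_re hint
  rw [h3, integral_const, smul_eq_mul] at h2
  have h4 : (ν : Measure ℝ).real univ = (ν.mass : ℝ) := rfl
  rw [h4] at h2
  linarith [re_le_norm (∫ θ, diskKernel (1 / 2) θ ∂(ν : Measure ℝ))]

/-- Robertson's representation on a smaller circle. -/
theorem exists_finiteMeasure_integral_diskKernel_eq {F : ℂ → ℂ}
    (hF : DifferentiableOn ℂ F (ball 0 1))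
    (him : ∀ w ∈ ball (0 : ℂ) 1, 0 ≤ w.im * (F w).im) {r : ℝ} (hr0 : 0 < r) (hr1 : r < 1) :
    ∃ ν : FiniteMeasure ℝ, ν (Icc 0 (2 * Real.pi))ᶜ = 0 ∧ ∀ ζ : ℂ, ‖ζ‖ < 1 →
      ∫ θ, diskKernel ζ θ ∂(ν : Measure ℝ) = F (r * ζ) - F 0 := by
  have hmap : MapsTo (fun w : ℂ => (r : ℂ) * w) (closedBall 0 1) (ball 0 1) := by
    intro w hw
    rw [mem_closedBall_zero_iff] at hw
    rw [mem_ball_zero_iff, norm_mul, norm_real, Real.norm_of_nonneg hr0.le]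
    nlinarith [norm_nonneg w]
  set G : ℂ → ℂ := fun w => F (r * w) with hG
  have hGd : DiffContOnCl ℂ G (ball 0 1) := by
    refine ⟨hF.comp (by fun_prop) (hmap.mono_left ball_subset_closedBall), ?_⟩
    rw [closure_ball _ one_ne_zero]
    exact hF.continuousOn.comp (by fun_prop) hmap
  have hGconj : ∀ w ∈ ball (0 : ℂ) 1, G (conj w) = conj (G w) := by
    intro w hw
    have := apply_conj_of_im_mul_im_nonneg hF him (hmap (ball_subset_closedBall hw))
    simpa [hG] using this
  have hcont : ContinuousOn G (closedBall 0 1) := by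
    rw [← closure_ball _ one_ne_zero]
    exact hGd.continuousOn
  have hGc : Continuous fun θ : ℝ => G (circleMap 0 1 θ) :=
    hcont.comp_continuous (continuous_circleMap 0 1) fun θ => by simp
  -- The Schwarz density; it is nonnegative because `sin θ` has the sign of the imaginary part of
  -- the boundary point.
  set ρ : ℝ → ℝ := fun θ => (2 * Real.pi)⁻¹ * ((G (circleMap 0 1 θ)).im * Real.sin θ) with hρ
  have hρc : Continuous ρ :=
    continuous_const.mul ((continuous_im.comp hGc).mul Real.continuous_sin)
  have hρ0 : ∀ θ, 0 ≤ ρ θ := by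
    intro θ
    have h1 := him _ (hmap (show circleMap 0 1 θ ∈ closedBall (0 : ℂ) 1 by simp))
    have h2 : ((r : ℂ) * circleMap 0 1 θ).im = r * Real.sin θ := by
      simp [circleMap, exp_ofReal_mul_I_im]
    rw [h2, mul_assoc] at h1
    have h3 := nonneg_of_mul_nonneg_right h1 hr0
    rw [mul_comm] at h3
    exact mul_nonneg (by positivity) h3
  have hint : IntegrableOn ρ (Ioc 0 (2 * Real.pi)) :=
    (hρc.integrableOn_Icc (a := 0) (b := 2 * Real.pi)).mono_set Ioc_subset_Icc_self
  have hfin := isFiniteMeasure_withDensity_ofReal hint.2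
  let ν : FiniteMeasure ℝ := ⟨(volume.restrict (Ioc 0 (2 * Real.pi))).withDensity
    fun θ => ENNReal.ofReal (ρ θ), hfin⟩
  have hν : (ν : Measure ℝ) = (volume.restrict (Ioc 0 (2 * Real.pi))).withDensity
    fun θ => ENNReal.ofReal (ρ θ) := rfl
  refine ⟨ν, ?_, fun ζ hζ => ?_⟩
  · rw [FiniteMeasure.null_iff_toMeasure_null, hν]
    refine withDensity_absolutelyContinuous _ _ ?_
    rw [Measure.restrict_apply measurableSet_Icc.compl]
    have : (Icc 0 (2 * Real.pi))ᶜ ∩ Ioc 0 (2 * Real.pi) = ∅ := by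
      rw [← disjoint_iff_inter_eq_empty]
      exact disjoint_compl_left_iff_subset.2 Ioc_subset_Icc_self
    rw [this, measure_empty]
  · rw [hν, integral_withDensity_eq_integral_toReal_smul
      (by fun_prop) (Eventually.of_forall fun θ => ENNReal.ofReal_lt_top)]
    have h1 := integral_im_mul_sin_mul_diskKernel hGd hGconj hζ
    rw [intervalIntegral.integral_of_le (by positivity)] at h1
    have h2 : ∀ θ : ℝ, (ENNReal.ofReal (ρ θ)).toReal • diskKernel ζ θ = (2 * Real.pi)⁻¹ •
        ((((G (circleMap 0 1 θ)).im * Real.sin θ : ℝ) : ℂ) * diskKernel ζ θ) := by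
      intro θ
      rw [ENNReal.toReal_ofReal (hρ0 θ), hρ]
      simp only [real_smul]
      push_cast
      ring
    simp only [h2]
    rw [integral_smul, h1, inv_smul_smul₀ (by positivity)]
    simp [hG]

/-- Robertson's representation of typically real functions on the unit disk. -/
theorem exists_measure_eq_integral_diskKernel {F : ℂ → ℂ}
    (hF : DifferentiableOn ℂ F (ball 0 1))
    (him : ∀ w ∈ ball (0 : ℂ) 1, 0 ≤ w.im * (F w).im) :
    ∃ ν : Measure ℝ, IsFiniteMeasure ν ∧ ∀ ζ : ℂ, ‖ζ‖ < 1 →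
      F ζ = F 0 + ∫ θ, diskKernel ζ θ ∂ν := by
  set r : ℕ → ℝ := fun n => 1 - 1 / ((n : ℝ) + 2) with hr
  have hr0 : ∀ n, 0 < r n := fun n => by
    rw [hr, sub_pos, div_lt_one (by positivity)]
    linarith [n.cast_nonneg (α := ℝ)]
  have hr1 : ∀ n, r n < 1 := fun n => by
    rw [hr, sub_lt_self_iff]
    positivity
  have hrlim : Tendsto r atTop (𝓝 1) := by
    have h1 : Tendsto (fun n : ℕ => 1 / ((n : ℝ) + 2)) atTop (𝓝 0) := by
      refine Tendsto.const_div_atTop ?_ _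
      exact tendsto_atTop_add_const_right _ _ tendsto_natCast_atTop_atTop
    simpa [hr] using h1.const_sub 1
  choose ν hν0 hν using fun n => exists_finiteMeasure_integral_diskKernel_eq hF him (hr0 n) (hr1 n)
  obtain ⟨C, hC⟩ := (isCompact_closedBall (0 : ℂ) (1 / 2)).exists_bound_of_continuousOn
    ((hF.continuousOn.mono (closedBall_subset_ball (by norm_num))).sub
      (continuousOn_const (c := F 0)))
  have hmass : ∀ n, (ν n).mass ≤ (9 / 4 * C).toNNReal := by
    intro n
    rw [← NNReal.coe_le_coe]
    refine ((mass_le_norm_integral_diskKernel (ν n)).trans ?_).trans (Real.le_coe_toNNReal _)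
    rw [hν n _ (by norm_num)]
    refine mul_le_mul_of_nonneg_left (hC _ ?_) (by norm_num)
    rw [mem_closedBall_zero_iff, norm_mul, norm_real, Real.norm_of_nonneg (hr0 n).le]
    have := hr1 n
    norm_num
    linarith
  -- Bounded mass on a fixed compact interval gives weak compactness; a limit along a nonprincipal
  -- ultrafilter replaces a convergent subsequence.
  obtain ⟨ν', -, hν'⟩ := isCompact_iff_ultrafilter_le_nhds.1
    (isCompact_setOfPred_finiteMeasure_le_of_isCompact (9 / 4 * C).toNNReal
      (isCompact_Icc (a := (0 : ℝ)) (b := 2 * Real.pi)))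
    ((hyperfilter ℕ).map ν) (by
      rw [le_principal_iff]
      exact Filter.mem_map.2 (Eventually.of_forall fun n => ⟨hmass n, hν0 n⟩))
  have htend : Tendsto ν (hyperfilter ℕ : Filter ℕ) (𝓝 ν') := hν'
  refine ⟨ν', inferInstance, fun ζ hζ => ?_⟩
  have h1 := (FiniteMeasure.tendsto_iff_forall_integral_rclike_tendsto ℂ).1 htend
    (BoundedContinuousFunction.ofNormedAddCommGroup (diskKernel ζ) (continuous_diskKernel hζ) _
      (norm_diskKernel_le hζ))
  simp only [BoundedContinuousFunction.coe_ofNormedAddCommGroup, hν _ ζ hζ] at h1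
  have h2 : Tendsto (fun n => F (r n * ζ) - F 0) atTop (𝓝 (F ζ - F 0)) := by
    have h3 : ContinuousAt F (1 * ζ) := by
      rw [one_mul]
      exact (hF.differentiableAt (isOpen_ball.mem_nhds (by simpa using hζ))).continuousAt
    have h4 : Tendsto (fun n => (r n : ℂ) * ζ) atTop (𝓝 (1 * ζ)) := by
      have := (continuous_ofReal.tendsto 1).comp hrlim
      rw [ofReal_one] at this
      exact this.mul_const ζ
    have h5 := h3.tendsto.comp h4
    rw [one_mul] at h5
    exact h5.sub_const _
  have h6 := tendsto_nhds_unique h1 (h2.mono_left Nat.hyperfilter_le_atTop)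
  rw [h6]
  ring

end Robertson

/-! ### Transfer from the disk to the cut plane. -/

section CutPlane

open Complex Metric ComplexConjugate

theorem one_add_ne_zero_of_norm_lt {ζ : ℂ} (hζ : ‖ζ‖ < 1) : 1 + ζ ≠ 0 := by
  simpa using one_sub_ne_zero_of_norm_lt (w := -ζ) (by simpa using hζ)

theorem cayley_re {ζ : ℂ} : ((1 - ζ) / (1 + ζ)).re = (1 - ‖ζ‖ ^ 2) / normSq (1 + ζ) := by
  rw [div_re, ← add_div, ← normSq_eq_norm_sq, normSq_apply ζ]
  simp
  ring

theorem cayley_im {ζ : ℂ} : ((1 - ζ) / (1 + ζ)).im = -2 * ζ.im / normSq (1 + ζ) := by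
  rw [div_im, ← sub_div]
  simp
  ring

theorem cayley_re_pos {ζ : ℂ} (hζ : ‖ζ‖ < 1) : 0 < ((1 - ζ) / (1 + ζ)).re := by
  rw [cayley_re]
  have := normSq_pos.2 (one_add_ne_zero_of_norm_lt hζ)
  have h2 := norm_nonneg ζ
  exact div_pos (by nlinarith) this

theorem neg_sq_mem_cutPlane {a : ℂ} (ha : 0 < a.re) : -a ^ 2 ∈ cutPlane := by
  rintro ⟨h1, h2⟩
  simp only [sq, neg_re, neg_im, mul_re, mul_im] at h1 h2
  have h3 : a.im = 0 := by
    have : a.re * a.im = 0 := by linarith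
    exact (mul_eq_zero.1 this).resolve_left ha.ne'
  rw [h3] at h1
  nlinarith

/-- The principal square root `a` of `-z` has positive real part, and `a ↦ (1 - a) / (1 + a)` is an
involution that takes the right half-plane into the disk. -/
theorem exists_neg_sq_eq_of_mem_cutPlane {z : ℂ} (hz : z ∈ cutPlane) :
    ∃ ζ : ℂ, ‖ζ‖ < 1 ∧ -((1 - ζ) / (1 + ζ)) ^ 2 = z := by
  have hz' : -z ∈ slitPlane := by
    rw [mem_slitPlane_iff]
    by_contra! h
    refine hz ⟨?_, ?_⟩
    · simpa using h.1
    · simpa using h.2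
  set a : ℂ := (-z) ^ (2⁻¹ : ℂ) with ha
  have ha2 : a ^ 2 = -z := by
    rw [ha]
    exact_mod_cast cpow_nat_inv_pow (-z) two_ne_zero
  have hre : 0 < a.re := by
    have hne := slitPlane_ne_zero hz'
    have h1 : a = exp (log (-z) * 2⁻¹) := by rw [ha, cpow_def_of_ne_zero hne]
    rw [h1, exp_re]
    refine mul_pos (Real.exp_pos _) (Real.cos_pos_of_mem_Ioo ?_)
    have h2 : (log (-z) * 2⁻¹).im = arg (-z) / 2 := by
      rw [show (2⁻¹ : ℂ) = ((2⁻¹ : ℝ) : ℂ) by simp, im_mul_ofReal, log_im, div_eq_mul_inv]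
    rw [h2]
    have h3 := neg_pi_lt_arg (-z)
    have h4 := (arg_le_pi (-z)).lt_of_ne (slitPlane_arg_ne_pi hz')
    constructor <;> linarith
  have h1a : 1 + a ≠ 0 := by
    intro h
    have := congrArg re h
    simp at this
    linarith
  refine ⟨(1 - a) / (1 + a), ?_, ?_⟩
  · rw [norm_div, div_lt_one (norm_pos_iff.2 h1a), ← sq_lt_sq₀ (norm_nonneg _) (norm_nonneg _),
      ← normSq_eq_norm_sq, ← normSq_eq_norm_sq, normSq_apply, normSq_apply]
    simp
    nlinarith
  · have h2 : (1 - (1 - a) / (1 + a)) / (1 + (1 - a) / (1 + a)) = a := by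
      have h3 : 1 + (1 - a) / (1 + a) ≠ 0 := by
        have : 1 + (1 - a) / (1 + a) = 2 / (1 + a) := by
          field_simp
          ring
        rw [this]
        exact div_ne_zero two_ne_zero h1a
      rw [div_eq_iff h3]
      field_simp
      ring
    rw [h2, ha2, neg_neg]

theorem diskKernel_eq_of_neg_sq {ζ : ℂ} (hζ : ‖ζ‖ < 1) {z : ℂ}
    (hz : -((1 - ζ) / (1 + ζ)) ^ 2 = z) (θ : ℝ) :
    diskKernel ζ θ =
      (1 + z) / (((1 - Real.cos θ : ℝ) : ℂ) - z * ((1 + Real.cos θ : ℝ) : ℂ)) := by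
  have h1 := one_add_ne_zero_of_norm_lt hζ
  have hsq : (1 + ζ) ^ 2 ≠ 0 := pow_ne_zero 2 h1
  rw [← hz, diskKernel, div_pow]
  have hn : 1 + -((1 - ζ) ^ 2 / (1 + ζ) ^ 2) = (2 * (2 * ζ)) / (1 + ζ) ^ 2 := by
    field_simp
    ring
  have hd : ((1 - Real.cos θ : ℝ) : ℂ) - -((1 - ζ) ^ 2 / (1 + ζ) ^ 2) *
      ((1 + Real.cos θ : ℝ) : ℂ) =
      (2 * (1 - 2 * (Real.cos θ : ℂ) * ζ + ζ ^ 2)) / (1 + ζ) ^ 2 := by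
    push_cast
    field_simp
    ring
  rw [hn, hd, div_div_div_cancel_right₀ hsq, mul_div_mul_left _ _ two_ne_zero]

/-- The representation of a function with `Im w * Im φ(w) ≥ 0` on the cut plane based at `-1`;
the parameter `x = cos θ` corresponds to `t = (1 - x) / (1 + x) ∈ [0, ∞]`. -/
theorem exists_measure_eq_integral_cutPlane {φ : ℂ → ℂ} (hφ : DifferentiableOn ℂ φ cutPlane)
    (him : ∀ w ∈ cutPlane, 0 ≤ w.im * (φ w).im) :
    ∃ ν : Measure ℝ, IsFiniteMeasure ν ∧ ∀ z ∈ cutPlane,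
      Integrable (fun θ : ℝ => (1 + z) /
        (((1 - Real.cos θ : ℝ) : ℂ) - z * ((1 + Real.cos θ : ℝ) : ℂ))) ν ∧
      φ z = φ (-1) + ∫ θ : ℝ, (1 + z) /
        (((1 - Real.cos θ : ℝ) : ℂ) - z * ((1 + Real.cos θ : ℝ) : ℂ)) ∂ν := by
  set F : ℂ → ℂ := fun ζ => φ (-((1 - ζ) / (1 + ζ)) ^ 2) with hFdef
  have hmaps : MapsTo (fun ζ : ℂ => -((1 - ζ) / (1 + ζ)) ^ 2) (ball 0 1) cutPlane :=
    fun ζ hζ => neg_sq_mem_cutPlane (cayley_re_pos (by simpa using hζ))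
  have hF : DifferentiableOn ℂ F (ball 0 1) := by
    refine hφ.comp (DifferentiableOn.neg (DifferentiableOn.pow (DifferentiableOn.div
      (by fun_prop) (by fun_prop) fun ζ hζ => ?_) 2)) hmaps
    exact one_add_ne_zero_of_norm_lt (by simpa using hζ)
  have hFim : ∀ w ∈ ball (0 : ℂ) 1, 0 ≤ w.im * (F w).im := by
    intro w hw
    have hw' : ‖w‖ < 1 := by simpa using hw
    have h1 := him _ (hmaps hw)
    -- The substitution multiplies the imaginary part by a positive factor, so the sign condition
    -- carries over.
    have h2 : (-((1 - w) / (1 + w)) ^ 2).im =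
        (4 * ((1 - w) / (1 + w)).re / normSq (1 + w)) * w.im := by
      rw [sq, neg_im, mul_im, cayley_im]
      ring
    simp only [h2, mul_assoc] at h1
    refine nonneg_of_mul_nonneg_right h1 ?_
    have := cayley_re_pos hw'
    have := normSq_pos.2 (one_add_ne_zero_of_norm_lt hw')
    positivity
  obtain ⟨ν, hν, h⟩ := exists_measure_eq_integral_diskKernel hF hFim
  refine ⟨ν, hν, fun z hz => ?_⟩
  obtain ⟨ζ, hζ, rfl⟩ := exists_neg_sq_eq_of_mem_cutPlane hz
  simp only [← diskKernel_eq_of_neg_sq hζ rfl]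
  refine ⟨integrable_diskKernel ν hζ, ?_⟩
  have := h ζ hζ
  simpa [hFdef] using this

end CutPlane

end HirschCalculus

/-! ### The integral representation and its normalization. -/

namespace HirschCalculus

section Representation

theorem neg_ofReal_mem_cutPlane {y : ℝ} (hy : 0 < y) : (-y : ℂ) ∈ cutPlane := by
  rintro ⟨h, -⟩
  simp at h
  linarith

theorem mem_cutPlane_or_eq_zero {z : ℂ} (hz : ¬ (0 < z.re ∧ z.im = 0)) : z ∈ cutPlane ∨ z = 0 := by
  by_cases h : z ∈ cutPlane
  · exact Or.inl h
  · right
    have h' : 0 ≤ z.re ∧ z.im = 0 := not_not.1 h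
    exact Complex.ext (le_antisymm (not_lt.1 fun h2 => hz ⟨h2, h'.2⟩) h'.1) h'.2

theorem cutPlane_kernel_denom_ne_zero {z : ℂ} (hz : z ∈ cutPlane) (θ : ℝ) :
    ((1 - Real.cos θ : ℝ) : ℂ) - z * ((1 + Real.cos θ : ℝ) : ℂ) ≠ 0 := by
  intro h
  have hre := congrArg Complex.re h
  have him := congrArg Complex.im h
  simp only [Complex.sub_re, Complex.sub_im, Complex.ofReal_re, Complex.ofReal_im,
    Complex.re_mul_ofReal, Complex.im_mul_ofReal, Complex.zero_re, Complex.zero_im, zero_sub,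
    neg_eq_zero, mul_eq_zero] at hre him
  have h1 := Real.cos_le_one θ
  have h2 := Real.neg_one_le_cos θ
  rcases him with him | him
  · refine hz ⟨?_, him⟩
    by_contra! hlt
    have h3 : z.re * (1 + Real.cos θ) ≤ 0 := mul_nonpos_of_nonpos_of_nonneg hlt.le (by linarith)
    rw [show Real.cos θ = 1 by linarith] at hre
    linarith
  · rw [him, mul_zero] at hre
    linarith

/-- If `φ` has a limit at zero from the left then `1 / (1 - cos θ)` is integrable for the measure
that represents `φ` on the cut plane, and the representation extends to zero. -/
theorem integrable_inv_one_sub_cos {φ : ℂ → ℂ}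
    (hlim : Tendsto (fun x : ℝ => φ (x : ℂ)) (𝓝[<] 0) (𝓝 (φ 0)))
    {ν : Measure ℝ} (hν : ∀ z ∈ cutPlane,
      Integrable (fun θ : ℝ => (1 + z) /
        (((1 - Real.cos θ : ℝ) : ℂ) - z * ((1 + Real.cos θ : ℝ) : ℂ))) ν ∧
      φ z = φ (-1) + ∫ θ : ℝ, (1 + z) /
        (((1 - Real.cos θ : ℝ) : ℂ) - z * ((1 + Real.cos θ : ℝ) : ℂ)) ∂ν) :
    (∀ᵐ θ ∂ν, 0 < 1 - Real.cos θ) ∧ Integrable (fun θ => (1 - Real.cos θ)⁻¹) ν ∧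
      φ 0 = φ (-1) + ∫ θ, (((1 - Real.cos θ)⁻¹ : ℝ) : ℂ) ∂ν := by
  set y : ℕ → ℝ := fun n => 1 / ((n : ℝ) + 2) with hy
  have hy0 : ∀ n, 0 < y n := fun n => by positivity
  have hy1 : ∀ n, y n ≤ 1 / 2 := fun n =>
    one_div_le_one_div_of_le two_pos (by linarith [n.cast_nonneg (α := ℝ)])
  have hylim : Tendsto y atTop (𝓝 0) :=
    (tendsto_atTop_add_const_right _ _ tendsto_natCast_atTop_atTop).const_div_atTop _
  clear_value y
  have hp (θ : ℝ) : 0 ≤ 1 - Real.cos θ := by linarith [Real.cos_le_one θ]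
  have hq (θ : ℝ) : 0 ≤ 1 + Real.cos θ := by linarith [Real.neg_one_le_cos θ]
  have hden (n : ℕ) (θ : ℝ) : 0 < 1 - Real.cos θ + y n * (1 + Real.cos θ) := by
    nlinarith [hy0 n, hy1 n, hp θ, hq θ]
  -- The kernel at `z = -y n`; since `y n ≤ 1/2` it is nonnegative, and `2 * f n` dominates `1 / (1
  -- - cos θ + 2 y n)`.
  set f : ℕ → ℝ → ℝ := fun n θ => (1 - y n) / (1 - Real.cos θ + y n * (1 + Real.cos θ)) with hf
  have hfk (n : ℕ) (θ : ℝ) : (1 + (-(y n) : ℂ)) /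
      (((1 - Real.cos θ : ℝ) : ℂ) - (-(y n) : ℂ) * ((1 + Real.cos θ : ℝ) : ℂ)) = (f n θ : ℂ) := by
    rw [hf]
    push_cast
    ring_nf
  have hrep : ∀ n, Integrable (fun θ => (f n θ : ℂ)) ν ∧
      φ (-(y n) : ℂ) = φ (-1) + ∫ θ, (f n θ : ℂ) ∂ν := fun n => by
    simpa only [hfk] using hν _ (neg_ofReal_mem_cutPlane (hy0 n))
  have hfint : ∀ n, Integrable (f n) ν := fun n => by simpa using (hrep n).1.re
  have hf0 : ∀ n θ, 0 ≤ f n θ := fun n θ =>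
    div_nonneg (by linarith [hy1 n]) (hden n θ).le
  have hφlim : Tendsto (fun n => φ (-(y n) : ℂ)) atTop (𝓝 (φ 0)) := by
    have h1 : Tendsto (fun n => -y n) atTop (𝓝[<] 0) := by
      refine tendsto_nhdsWithin_iff.2 ⟨by simpa using hylim.neg, Eventually.of_forall fun n => ?_⟩
      simpa using hy0 n
    simpa [Function.comp_def] using hlim.comp h1
  have hintlim : Tendsto (fun n => ∫ θ, f n θ ∂ν) atTop (𝓝 (φ 0 - φ (-1)).re) := by
    have h1 : ∀ n, ∫ θ, f n θ ∂ν = (φ (-(y n) : ℂ) - φ (-1)).re := fun n => by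
      rw [(hrep n).2, add_sub_cancel_left, integral_complex_ofReal, Complex.ofReal_re]
    simp only [h1]
    exact (Complex.continuous_re.tendsto _).comp (hφlim.sub_const _)
  set D : ℝ := 2 * ((φ 0 - φ (-1)).re + 1) with hD
  -- The inverse in `ENNReal` is `∞` where `cos θ = 1`, so a finite integral also shows that this
  -- set is null. The `+ 1` in `D` is slack over the limit of the integrals.
  have hfatou : ∫⁻ θ, (ENNReal.ofReal (1 - Real.cos θ))⁻¹ ∂ν ≤ ENNReal.ofReal D := by
    have h1 : ∀ θ, liminf (fun n => (ENNReal.ofReal (1 - Real.cos θ + 2 * y n))⁻¹) atTop =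
        (ENNReal.ofReal (1 - Real.cos θ))⁻¹ := by
      intro θ
      refine Tendsto.liminf_eq ?_
      refine ((continuous_inv (G := ENNReal)).tendsto _).comp (ENNReal.tendsto_ofReal ?_)
      simpa using (hylim.const_mul 2).const_add (1 - Real.cos θ)
    simp only [← h1]
    refine (lintegral_liminf_le fun n => by fun_prop).trans ?_
    refine liminf_le_of_frequently_le' (Eventually.frequently ?_)
    filter_upwards [hintlim.eventually (gt_mem_nhds (lt_add_one _))] with n hn
    have h2 : ∀ θ, (ENNReal.ofReal (1 - Real.cos θ + 2 * y n))⁻¹ ≤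
        ENNReal.ofReal (2 * f n θ) := by
      intro θ
      have hpos : 0 < 1 - Real.cos θ + 2 * y n := by linarith [hp θ, hy0 n]
      rw [← ENNReal.ofReal_inv_of_pos hpos]
      refine ENNReal.ofReal_le_ofReal ?_
      have h3 : 1 - Real.cos θ + y n * (1 + Real.cos θ) ≤ 1 - Real.cos θ + 2 * y n := by
        nlinarith [hy0 n, hp θ]
      have h4 : 2 * f n θ =
          (2 * (1 - y n)) / (1 - Real.cos θ + y n * (1 + Real.cos θ)) := by
        simp only [hf, mul_div_assoc]
      rw [h4, ← one_div]
      exact div_le_div₀ (by linarith [hy1 n]) (by linarith [hy1 n]) (hden n θ) h3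
    refine (lintegral_mono h2).trans ?_
    rw [← ofReal_integral_eq_lintegral_ofReal ((hfint n).const_mul 2)
      (Eventually.of_forall fun θ => mul_nonneg two_pos.le (hf0 n θ)), integral_const_mul]
    exact ENNReal.ofReal_le_ofReal (by linarith)
  have hfin := hfatou.trans_lt ENNReal.ofReal_lt_top
  have hae : ∀ᵐ θ ∂ν, 0 < 1 - Real.cos θ := by
    filter_upwards [ae_lt_top (by fun_prop) hfin.ne] with θ hθ
    rw [ENNReal.inv_lt_top, ENNReal.ofReal_pos] at hθ
    exact hθ
  have hinv : Integrable (fun θ => (1 - Real.cos θ)⁻¹) ν := by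
    refine ⟨(by fun_prop : Measurable fun θ : ℝ => (1 - Real.cos θ)⁻¹).aestronglyMeasurable, ?_⟩
    rw [hasFiniteIntegral_iff_ofReal (Eventually.of_forall fun θ => inv_nonneg.2 (hp θ))]
    refine lt_of_le_of_lt (lintegral_mono_ae ?_) hfin
    filter_upwards [hae] with θ hθ
    rw [ENNReal.ofReal_inv_of_pos hθ]
  refine ⟨hae, hinv, ?_⟩
  have hdct : Tendsto (fun n => ∫ θ, f n θ ∂ν) atTop (𝓝 (∫ θ, (1 - Real.cos θ)⁻¹ ∂ν)) := by
    refine tendsto_integral_of_dominated_convergence _ (fun n => (hfint n).1) hinv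
      (fun n => ?_) ?_
    · filter_upwards [hae] with θ hθ
      rw [Real.norm_of_nonneg (hf0 n θ), ← one_div, div_le_div_iff₀ (hden n θ) hθ]
      nlinarith [hy0 n, hq θ, mul_nonneg (hy0 n).le (hq θ), mul_nonneg (hy0 n).le hθ.le]
    · filter_upwards [hae] with θ hθ
      have h1 : Tendsto (fun n => (1 - y n) / (1 - Real.cos θ + y n * (1 + Real.cos θ))) atTop
          (𝓝 ((1 - 0) / (1 - Real.cos θ + 0 * (1 + Real.cos θ)))) :=
        (hylim.const_sub 1).div ((hylim.mul_const _).const_add _) (by simpa using hθ.ne')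
      simpa using h1
  have hdct' : Tendsto (fun n => φ (-(y n) : ℂ)) atTop
      (𝓝 (φ (-1) + ((∫ θ, (1 - Real.cos θ)⁻¹ ∂ν : ℝ) : ℂ))) := by
    have h1 : ∀ n, φ (-(y n) : ℂ) = φ (-1) + ((∫ θ, f n θ ∂ν : ℝ) : ℂ) := fun n => by
      rw [(hrep n).2, integral_complex_ofReal]
    simp only [h1]
    exact ((Complex.continuous_ofReal.tendsto _).comp hdct).const_add _
  rw [integral_complex_ofReal]
  exact tendsto_nhds_unique hφlim hdct'

/-- The integral representation of negative complete Bernstein functions. -/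
theorem IsNegCompleteBernstein.exists_isRepresentation {φ : ℂ → ℂ}
    (hφ : IsNegCompleteBernstein φ) (h0 : (φ 0).re ≤ 0) :
    ∃ (μ : Measure ℝ) (c b : ℝ), IsRepresentation φ c b μ := by
  obtain ⟨ν, hfin, hν⟩ := exists_measure_eq_integral_cutPlane hφ.holomorphic hφ.im_mul_im_nonneg
  obtain ⟨hae, hinv, hzero⟩ := integrable_inv_one_sub_cos hφ.tendsto_zero hν
  set T : ℝ → ℝ := fun θ => (1 - Real.cos θ) / (1 + Real.cos θ) with hT
  have hTm : Measurable T := by fun_prop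
  -- This set corresponds to `t = ∞`; there the rebased kernel `k` equals `z / 2`, whence `b = ν(S)
  -- / 2`.
  set S : Set ℝ := {θ | 1 + Real.cos θ = 0} with hS
  have hSm : MeasurableSet S :=
    measurableSet_eq_fun (by fun_prop) measurable_const
  -- With `p = 1 - cos θ`, `q = 1 + cos θ` and `p + q = 2`, one has `(1 + z) / (p - z q) - 1 / p =
  -- (2 / (p q)) · z / (p / q - z)`.
  set w : ℝ → ℝ := fun θ => 2 / ((1 - Real.cos θ) * (1 + Real.cos θ)) with hw
  have hwm : Measurable w := by fun_prop
  have hp (θ : ℝ) : 0 ≤ 1 - Real.cos θ := by linarith [Real.cos_le_one θ]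
  have hq (θ : ℝ) : 0 ≤ 1 + Real.cos θ := by linarith [Real.neg_one_le_cos θ]
  have hw0 : ∀ θ, 0 ≤ w θ := fun θ => div_nonneg two_pos.le (mul_nonneg (hp θ) (hq θ))
  set κ : Measure ℝ := (ν.restrict Sᶜ).withDensity fun θ => ENNReal.ofReal (w θ) with hκ
  have hκae : ∀ᵐ θ ∂κ, 0 < T θ := by
    refine (withDensity_absolutelyContinuous _ _).ae_le ?_
    filter_upwards [ae_restrict_mem hSm.compl, ae_restrict_of_ae hae] with θ h1 h2
    exact div_pos h2 ((hq θ).lt_of_ne' h1)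
  set μ : Measure ℝ := κ.map T with hμ
  have hnull : μ (Iic 0) = 0 := by
    rw [hμ, Measure.map_apply hTm measurableSet_Iic]
    have h1 : T ⁻¹' Iic 0 = {θ | ¬ 0 < T θ} := by
      ext θ
      simp
    rw [h1]
    exact ae_iff.1 hκae
  have hrestrict : μ.restrict (Ioi 0) = μ := by
    refine Measure.restrict_eq_self_of_ae_mem (ae_iff.2 ?_)
    have h1 : {t : ℝ | t ∉ Ioi 0} = Iic 0 := by
      ext t
      simp
    rwa [h1]
  have htop : ∀ᵐ θ ∂(ν.restrict Sᶜ), ENNReal.ofReal (w θ) < ⊤ :=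
    Eventually.of_forall fun θ => ENNReal.ofReal_lt_top
  refine ⟨μ, (φ 0).re, ν.real S / 2, h0, by positivity, hnull, ?_, fun z hz => ?_⟩
  · rw [IntegrableOn, hrestrict, hμ, integrable_map_measure
      (by fun_prop : Measurable fun t : ℝ => (1 + t)⁻¹).aestronglyMeasurable hTm.aemeasurable,
      hκ, integrable_withDensity_iff_integrable_smul' (by fun_prop) htop]
    -- Since `1 + T = 2 / (1 + cos θ)`, the weighted integrand is exactly `1 / (1 - cos θ)`.
    refine (hinv.restrict (s := Sᶜ)).congr ?_
    filter_upwards [ae_restrict_mem hSm.compl, ae_restrict_of_ae hae] with θ h1 h2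
    have h3 : 1 + Real.cos θ ≠ 0 := h1
    have h4 : 1 + T θ = 2 / (1 + Real.cos θ) := by
      rw [hT]
      field_simp
      ring
    rw [ENNReal.toReal_ofReal (hw0 θ), Function.comp_apply, h4, hw, smul_eq_mul]
    have := h2.ne'
    field_simp
  · rw [hrestrict]
    have hc : ((φ 0).re : ℂ) = φ 0 := Complex.ext rfl hφ.real_zero.symm
    rw [hc]
    rcases mem_cutPlane_or_eq_zero hz with hz | rfl
    swap
    · simp
    obtain ⟨hint, heq⟩ := hν z hz
    set k : ℝ → ℂ := fun θ => (1 + z) /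
      (((1 - Real.cos θ : ℝ) : ℂ) - z * ((1 + Real.cos θ : ℝ) : ℂ)) -
        (((1 - Real.cos θ)⁻¹ : ℝ) : ℂ) with hk
    have hkint : Integrable k ν := hint.sub hinv.ofReal
    have h1 : φ z = φ 0 + ∫ θ, k θ ∂ν := by
      have h2 := integral_sub hint hinv.ofReal
      simp only [hk]
      rw [hzero, heq, add_assoc]
      refine congrArg _ (eq_add_of_sub_eq' ?_)
      exact h2.symm
    have h2 : ∫ θ in S, k θ ∂ν = (ν.real S / 2 : ℝ) * z := by
      have h3 : ∀ θ ∈ S, k θ = z / 2 := by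
        intro θ hθ
        have h4 : Real.cos θ = -1 := by
          have : 1 + Real.cos θ = 0 := hθ
          linarith
        simp only [hk, h4]
        push_cast
        ring
      rw [setIntegral_congr_fun hSm h3, setIntegral_const, Complex.real_smul]
      push_cast
      ring
    have h5 : ∫ θ in Sᶜ, k θ ∂ν = ∫ t, z / ((t : ℂ) - z) ∂μ := by
      rw [hμ, integral_map hTm.aemeasurable
        (by fun_prop : Measurable fun t : ℝ => z / ((t : ℂ) - z)).aestronglyMeasurable, hκ,
        integral_withDensity_eq_integral_toReal_smul (by fun_prop) htop]
      refine integral_congr_ae ?_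
      filter_upwards [ae_restrict_mem hSm.compl, ae_restrict_of_ae hae] with θ h1 h2
      have h3 : ((1 + Real.cos θ : ℝ) : ℂ) ≠ 0 := Complex.ofReal_ne_zero.2 h1
      have h4 : ((1 - Real.cos θ : ℝ) : ℂ) ≠ 0 := Complex.ofReal_ne_zero.2 h2.ne'
      have h6 := cutPlane_kernel_denom_ne_zero hz θ
      have h7 : ((1 + Real.cos θ : ℝ) : ℂ) = 2 - ((1 - Real.cos θ : ℝ) : ℂ) := by
        push_cast
        ring
      rw [ENNReal.toReal_ofReal (hw0 θ), Complex.real_smul]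
      simp only [hk, hw, hT, Complex.ofReal_div, Complex.ofReal_mul, Complex.ofReal_inv,
        Complex.ofReal_ofNat]
      have h8 : ((1 - Real.cos θ : ℝ) : ℂ) / ((1 + Real.cos θ : ℝ) : ℂ) - z =
          (((1 - Real.cos θ : ℝ) : ℂ) - z * ((1 + Real.cos θ : ℝ) : ℂ)) /
            ((1 + Real.cos θ : ℝ) : ℂ) := by
        field_simp
      rw [h8]
      generalize ((1 - Real.cos θ : ℝ) : ℂ) = p at *
      generalize ((1 + Real.cos θ : ℝ) : ℂ) = q at *
      field_simp
      rw [h7]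
      ring
    rw [h1, ← integral_add_compl hSm hkint, h2, h5]
    push_cast
    ring

theorem IsRepresentation.apply_zero {φ : ℂ → ℂ} {c b : ℝ} {μ : Measure ℝ}
    (h : IsRepresentation φ c b μ) : φ 0 = c := by
  simpa using h.eq_integral 0 (by simp)

theorem IsRepresentation.apply_neg {φ : ℂ → ℂ} {c b : ℝ} {μ : Measure ℝ}
    (h : IsRepresentation φ c b μ) {d : ℝ} (hd : 0 ≤ d) :
    φ ((-d : ℝ) : ℂ) = ((c - b * d - ∫ t in Ioi (0 : ℝ), d / (t + d) ∂μ : ℝ) : ℂ) := by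
  rw [h.eq_integral _ (by simp [hd])]
  have h1 : ∀ t : ℝ, ((-d : ℝ) : ℂ) / ((t : ℂ) - ((-d : ℝ) : ℂ)) = ((-(d / (t + d)) : ℝ) : ℂ) := by
    intro t
    push_cast
    rw [sub_neg_eq_add, neg_div]
  simp only [h1]
  rw [integral_complex_ofReal, integral_neg]
  push_cast
  ring

/-- At `x = -d` the quotient is `b - c / d + ∫ 1 / (t + d) dμ`, dominated by `1 / (1 + t)` for `d ≥
1`. So `b` is determined by `φ`. -/
theorem IsRepresentation.tendsto_div_atBot {φ : ℂ → ℂ} {c b : ℝ} {μ : Measure ℝ}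
    (h : IsRepresentation φ c b μ) :
    Tendsto (fun x : ℝ => φ (x : ℂ) / (x : ℂ)) atBot (𝓝 (b : ℂ)) := by
  have hint : Tendsto (fun d : ℝ => ∫ t in Ioi (0 : ℝ), (t + d)⁻¹ ∂μ) atTop (𝓝 0) := by
    suffices h0 : Tendsto (fun d : ℝ => ∫ t in Ioi (0 : ℝ), (t + d)⁻¹ ∂μ) atTop
        (𝓝 (∫ _t in Ioi (0 : ℝ), (0 : ℝ) ∂μ)) by simpa using h0
    refine tendsto_integral_filter_of_dominated_convergence
      (fun t : ℝ => (1 + t)⁻¹) ?_ ?_ h.integrable ?_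
    · exact Eventually.of_forall fun d =>
        (by fun_prop : Measurable fun t : ℝ => (t + d)⁻¹).aestronglyMeasurable
    · filter_upwards [eventually_ge_atTop 1] with d hd
      refine (ae_restrict_iff' measurableSet_Ioi).2 (Eventually.of_forall fun t ht => ?_)
      have ht0 : (0 : ℝ) < t := ht
      rw [Real.norm_of_nonneg (by positivity)]
      exact inv_anti₀ (by positivity) (by linarith)
    · exact Eventually.of_forall fun t =>
        tendsto_inv_atTop_zero.comp (tendsto_atTop_add_const_left atTop t tendsto_id)
  have hlim : Tendsto (fun d : ℝ => b - c / d + ∫ t in Ioi (0 : ℝ), (t + d)⁻¹ ∂μ) atTop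
      (𝓝 b) := by
    have h1 : Tendsto (fun d : ℝ => c / d) atTop (𝓝 0) := tendsto_id.const_div_atTop c
    simpa using (h1.const_sub b).add hint
  have hlim' : Tendsto (fun d : ℝ => φ ((-d : ℝ) : ℂ) / ((-d : ℝ) : ℂ)) atTop (𝓝 (b : ℂ)) := by
    refine ((Complex.continuous_ofReal.tendsto b).comp hlim).congr' ?_
    filter_upwards [eventually_gt_atTop 0] with d hd
    rw [h.apply_neg hd.le, Function.comp_apply, ← Complex.ofReal_div]
    congr 1
    simp only [div_eq_mul_inv, integral_const_mul]
    field_simp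
    ring
  have := hlim'.comp tendsto_neg_atBot_atTop
  simpa [Function.comp_def] using this

/-- Uniqueness of `μ` is not needed: `φ` determines `c` and `b`, so whichever measure was chosen
comes with `c = b = 0`. -/
theorem isRepresentation_representingMeasure {φ : ℂ → ℂ} (hφ : IsNegCompleteBernstein φ)
    (hc : φ 0 = 0) (hb : Tendsto (fun x : ℝ => φ (x : ℂ) / (x : ℂ)) atBot (𝓝 0)) :
    IsRepresentation φ 0 0 (representingMeasure φ) := by
  have h := hφ.exists_isRepresentation (by simp [hc])
  rw [representingMeasure, dif_pos h]
  obtain ⟨c, b, hr⟩ := h.choose_spec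
  have h1 : c = 0 := by
    have := hr.apply_zero
    rw [hc] at this
    exact_mod_cast this.symm
  have h2 : b = 0 := by exact_mod_cast tendsto_nhds_unique hr.tendsto_div_atBot hb
  rwa [h1, h2] at hr

end Representation

end HirschCalculus

/-! ### The perturbation estimate. -/

theorem proposition3p1 {X : Type*} [NormedAddCommGroup X] [NormedSpace ℂ X] [CompleteSpace X]
    (φ : ℂ → ℂ) (hφ : HirschCalculus.IsNegCompleteBernstein φ)
    -- the normalization `c = φ(-0) = 0` and `b = lim_{x → -∞} φ(x) / x = 0`
    (hc : φ 0 = 0)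
    (hb : Tendsto (fun x : ℝ => φ (x : ℂ) / (x : ℂ)) atBot (𝓝 0))
    (A B : X →ₗ.[ℂ] X)
    (hA : HirschCalculus.IsNonpositive A) (hB : HirschCalculus.IsNonpositive B)
    (hAB : A.domain ≤ B.domain) (hbdd : HirschCalculus.IsBoundedOp (A - B)) :
    HirschCalculus.IsBoundedOp
        (HirschCalculus.operatorFunction φ A - HirschCalculus.operatorFunction φ B) ∧
      HirschCalculus.opNorm
          (HirschCalculus.operatorFunction φ A - HirschCalculus.operatorFunction φ B) ≤
        -(HirschCalculus.boundConst A + HirschCalculus.boundConst B +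
            HirschCalculus.boundConst A * HirschCalculus.boundConst B) *
          (φ ((-HirschCalculus.opNorm (A - B) : ℝ) : ℂ)).re := by
  have hr := HirschCalculus.isRepresentation_representingMeasure hφ hc hb
  have hμ := hr.integrable
  have hd := HirschCalculus.opNorm_nonneg (A - B)
  have hdom : (HirschCalculus.integralOperator (HirschCalculus.representingMeasure φ) A).domain ≤
      (HirschCalculus.integralOperator (HirschCalculus.representingMeasure φ) B).domain := by
    rwa [HirschCalculus.integralOperator_domain hA hμ, HirschCalculus.integralOperator_domain hB hμ]
  have hmain := HirschCalculus.norm_closure_sub_closure_le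
    (HirschCalculus.isClosable_integralOperator hA hμ)
    (HirschCalculus.isClosable_integralOperator hB hμ) hdom
    (HirschCalculus.norm_integralOperator_sub_le hA hB hAB hbdd hμ)
  refine ⟨⟨_, hmain⟩, ?_⟩
  -- Here `-φ(-d)` becomes the integral of `d / (t + d)` that appears in `hmain`.
  rw [hr.apply_neg hd, Complex.ofReal_re]
  refine (HirschCalculus.opNorm_le ?_ hmain).trans (le_of_eq (by ring))
  have hMA := HirschCalculus.boundConst_nonneg A
  have hMB := HirschCalculus.boundConst_nonneg B
  refine mul_nonneg (by positivity) (setIntegral_nonneg measurableSet_Ioi fun t ht => ?_)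
  have ht0 : (0 : ℝ) < t := ht
  positivity
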